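/- Let $\mathbf X_{ik}=(X_{ijk})_{j=1}^d$, $i=1,\dots,a$, $k\in\mathbb N$, be independent $\mathbb R^d$-valued random vectors such that, within each group $i$, all $\mathbf X_{ik}$ have the same distribution, with arbitrary marginals. Let $F_{ij}(t)=\frac12\{P(X_{ij1}<t)+P(X_{ij1}\le t)\}$ be the normalized distribution function of $X_{ij1}$, and let $w_{\ell ij}=\int F_{\ell j}\,dF_{ij}=E[F_{\ell j}(X_{ij1})]$. From group $i$ the vectors $\mathbf X_{i1},\dots,\mathbf X_{in_i}$ are observed; $N=\sum_i n_i$, $\mathbf X$ is the pooled sample, $c(u)=\mathbf 1\{u>0\}+\frac12\mathbf 1\{u=0\}$, $\widehat F_{ij}(t)=\frac1{n_i}\sum_{k=1}^{n_i}c(t-X_{ijk})$ and $\widehat G_j=\frac1a\sum_{\ell=1}^a\widehat F_{\ell j}$. Let $D_{\ell k}$, $\ell=1,\dots,a$, $k\in\mathbb N$, be i.i.d. real random variables, independent of all the $\mathbf X_{ik}$, with mean zero, variance one and $\int_0^\infty\sqrt{P(|D_{11}|>x)}\,dx<\infty$. Put $$F^\star_{\ell j}(t)=\frac1{n_\ell}\sum_{k=1}^{n_\ell}D_{\ell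 k}\bigl[c(t-X_{\ell jk})-\widehat F_{\ell j}(t)\bigr],\qquad G^\star_j=\frac1a\sum_{\ell=1}^aF^\star_{\ell j},$$ $$p^\star_{ij}=\int G^\star_j\,d\widehat F_{ij}-\int F^\star_{ij}\,d\widehat G_j,\qquad \mathbf p^\star=\sqrt N\,(p^\star_{11},p^\star_{12},\dots,p^\star_{ad})'.$$ Suppose that, as $N\to\infty$, $n_i/N\to\lambda_i\in(0,1)$ for every $i=1,\dots,a$. Then, conditionally on $\mathbf X$, $$\mathbf p^\star\stackrel{d}{\longrightarrow}\mathbf Z\sim N_{ad}(\mathbf 0,\boldsymbol\Sigma)\quad\text{in outer probability},$$ that is, the bounded Lipschitz distance between the conditional distribution of $\mathbf p^\star$ given $\mathbf X$ and $N_{ad}(\mathbf 0,\boldsymbol\Sigma)$ tends to zero in outer probability. Here $\boldsymbol\Sigma$ is the positive semidefinite matrix with entries $$\Sigma_{(i,j),(i',j')}=\frac1{a^2}\sum_{\ell=1}^a\sum_{\ell'=1}^a\Bigl[\frac{\delta_{\ell\ell'}}{\lambda_\ell}\kappa_{\ell}(ij,i'j')-\frac{\delta_{\ell i'}}{\lambda_\ell}\kappa_{\ell}(ij,\ell'j')+\frac{\delta_{ii'}}{\lambda_i}\kappa_{i}(\ell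 j,\ell'j')-\frac{\delta_{i\ell'}}{\lambda_i}\kappa_{i}(\ell j,i'j')\Bigr],$$ where $\delta$ is Kronecker's delta and $$\kappa_\ell(ij,i'j')=\operatorname{cov}\bigl(F_{ij}(X_{\ell j1}),F_{i'j'}(X_{\ell j'1})\bigr)=E\bigl[F_{ij}(X_{\ell j1})F_{i'j'}(X_{\ell j'1})\bigr]-w_{i\ell j}\,w_{i'\ell j'}.$$ No hypothesis is imposed on the effects $p_{ij}=\frac1a\sum_{\ell=1}^a w_{\ell ij}$; in particular, for a hypothesis matrix $\mathbf T$ and $\mathbf p=(p_{11},p_{12},\dots,p_{ad})'$, the result holds both under $\mathbf T\mathbf p=\mathbf 0$ and under $\mathbf T\mathbf p\ne\mathbf 0$. -/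

import Mathlib

open MeasureTheory ProbabilityTheory Filter Topology

namespace MannWhitney

noncomputable section

/-! ### Population quantities

`Q i` is the common law on `ℝ^d` of the observation vectors of group `i`. -/

/-- The law of the `j`-th component of an observation in group `i`. -/
def marginal {a d : ℕ} (Q : Fin a → Measure (Fin d → ℝ)) (i : Fin a) (j : Fin d) : Measure ℝ :=
  (Q i).map (fun x => x j)

/-- The normalized distribution function `F_{ij}`, the mean of the left- and the right-continuous
version of the distribution function of the `j`-th component in group `i`. -/
def normCDF {a d : ℕ} (Q : Fin a → Measure (Fin d → ℝ)) (i : Fin a) (j : Fin d) (t : ℝ) : ℝ :=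
  ((marginal Q i j).real (Set.Iio t) + (marginal Q i j).real (Set.Iic t)) / 2

/-- The Mann-Whitney effect `w_{ℓij} = ∫ F_{ℓj} dF_{ij}`. -/
def effect {a d : ℕ} (Q : Fin a → Measure (Fin d → ℝ)) (l i : Fin a) (j : Fin d) : ℝ :=
  ∫ t, normCDF Q l j t ∂(marginal Q i j)

/-- `ρ_{ii'ℓjj'} = ∫ F_{ij}(u) F_{i'j'}(v) dF_{ℓjj'}(u,v)`, where `F_{ℓjj'}` is the joint
distribution of the components `j` and `j'` in group `ℓ`; for `j = j'` this is
`τ_{ii'ℓj} = ∫ F_{ij} F_{i'j} dF_{ℓj}`. -/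
def crossMoment {a d : ℕ} (Q : Fin a → Measure (Fin d → ℝ)) (i i' l : Fin a) (j j' : Fin d) : ℝ :=
  ∫ x, normCDF Q i j (x j) * normCDF Q i' j' (x j') ∂(Q l)

/-- `cov(F_{ij}(X_{ℓj1}), F_{i'j'}(X_{ℓj'1})) = ρ_{ii'ℓjj'} - w_{iℓj} w_{i'ℓj'}`. -/
def crossCov {a d : ℕ} (Q : Fin a → Measure (Fin d → ℝ)) (i i' l : Fin a) (j j' : Fin d) : ℝ :=
  crossMoment Q i i' l j j' - effect Q i l j * effect Q i' l j'

/-- `σ_{ℓij,ℓ'i'j'}`, the asymptotic covariance of the estimators (scaled by `√N`) of the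
Mann-Whitney effects `w_{ℓij}` and `w_{ℓ'i'j'}`; `lam i` is the limiting fraction of group `i`. -/
def sigma {a d : ℕ} (Q : Fin a → Measure (Fin d → ℝ)) (lam : Fin a → ℝ)
    (l i : Fin a) (j : Fin d) (l' i' : Fin a) (j' : Fin d) : ℝ :=
  (if l = l' then 1 / lam l * crossCov Q i i' l j j' else 0)
    - (if l = i' then 1 / lam l * crossCov Q i l' l j j' else 0)
    + (if i = i' then 1 / lam i * crossCov Q l l' i j j' else 0)
    - (if i = l' then 1 / lam i * crossCov Q l i' i j j' else 0)

/-- The limiting covariance matrix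
`Σ_{(i,j),(i',j')} = a⁻² ∑_ℓ ∑_ℓ' σ_{ℓij,ℓ'i'j'}` of `√N (p̂ - p)`. -/
def limitCov {a d : ℕ} (Q : Fin a → Measure (Fin d → ℝ)) (lam : Fin a → ℝ) :
    Matrix (Fin a × Fin d) (Fin a × Fin d) ℝ :=
  Matrix.of fun r s => 1 / (a : ℝ) ^ 2 * ∑ l, ∑ l', sigma Q lam l r.1 r.2 l' s.1 s.2

/-! ### The wild bootstrap statistic

`n i` is the size of sample `i`, `x i k` is the observation vector and `m i k` the multiplier of
individual `k < n i` in group `i`. -/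

/-- `c(u) = 1{u > 0} + 1{u = 0} / 2`. -/
def cFun (u : ℝ) : ℝ := (if 0 < u then 1 else 0) + (if u = 0 then 1 / 2 else 0)

/-- The normalized empirical distribution function `F̂_{ij}`. -/
def empCDF {a d : ℕ} (n : Fin a → ℕ) (x : Fin a → ℕ → Fin d → ℝ) (i : Fin a) (j : Fin d)
    (t : ℝ) : ℝ :=
  1 / (n i : ℝ) * ∑ k ∈ Finset.range (n i), cFun (t - x i k j)

/-- The integral `∫ f dF̂_{ij}`, i.e. the average of `f` over the sample of component `j` in
group `i`. -/
def empIntegral {a d : ℕ} (n : Fin a → ℕ) (x : Fin a → ℕ → Fin d → ℝ) (i : Fin a) (j : Fin d)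
    (f : ℝ → ℝ) : ℝ :=
  1 / (n i : ℝ) * ∑ k ∈ Finset.range (n i), f (x i k j)

/-- The wild bootstrap version `F⋆_{ij}` of `F̂_{ij} - F_{ij}`, the average over `k` of the
residuals `D_{ik} (c(t - X_{ijk}) - F̂_{ij}(t))`. The multiplier does not depend on `j`. -/
def bootCDF {a d : ℕ} (n : Fin a → ℕ) (x : Fin a → ℕ → Fin d → ℝ) (m : Fin a → ℕ → ℝ)
    (i : Fin a) (j : Fin d) (t : ℝ) : ℝ :=
  1 / (n i : ℝ) * ∑ k ∈ Finset.range (n i), m i k * (cFun (t - x i k j) - empCDF n x i j t)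

/-- `G⋆_j = a⁻¹ ∑_ℓ F⋆_{ℓj}`. -/
def bootMeanCDF {a d : ℕ} (n : Fin a → ℕ) (x : Fin a → ℕ → Fin d → ℝ) (m : Fin a → ℕ → ℝ)
    (j : Fin d) (t : ℝ) : ℝ :=
  1 / (a : ℝ) * ∑ l, bootCDF n x m l j t

/-- `p⋆_{ij} = ∫ G⋆_j dF̂_{ij} - ∫ F⋆_{ij} dĜ_j`, where `Ĝ_j = a⁻¹ ∑_ℓ F̂_{ℓj}`. -/
def bootEffect {a d : ℕ} (n : Fin a → ℕ) (x : Fin a → ℕ → Fin d → ℝ) (m : Fin a → ℕ → ℝ)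
    (i : Fin a) (j : Fin d) : ℝ :=
  empIntegral n x i j (bootMeanCDF n x m j)
    - 1 / (a : ℝ) * ∑ l, empIntegral n x l j (bootCDF n x m i j)

/-- The total sample size `N`. -/
def totalSize {a : ℕ} (n : Fin a → ℕ) : ℕ := ∑ i, n i

/-- The wild bootstrap effect vector `p⋆ = √N (p⋆_{11}, p⋆_{12}, …, p⋆_{ad})'`. -/
def bootVector {a d : ℕ} (n : Fin a → ℕ) (x : Fin a → ℕ → Fin d → ℝ) (m : Fin a → ℕ → ℝ) :
    EuclideanSpace ℝ (Fin a × Fin d) :=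
  WithLp.toLp 2 fun s => √(totalSize n : ℝ) * bootEffect n x m s.1 s.2

/-- The pooled sample of the observation vectors `x i k`, `k < n i`. -/
def pooled {a d : ℕ} (n : Fin a → ℕ) (x : Fin a → ℕ → Fin d → ℝ) :
    ((i : Fin a) × Fin (n i)) → Fin d → ℝ :=
  fun s => x s.1 s.2

/-! ### The bounded Lipschitz distance -/

/-- The bounded Lipschitz distance `sup_h |∫ h dμ - ∫ h dν|` of two probability measures, over all
`h` with values in `[-1, 1]` and Lipschitz constant at most `1`. It metrizes weak convergence. -/
def dBL {E : Type*} [MeasurableSpace E] [PseudoEMetricSpace E] (μ ν : Measure E) : ℝ :=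
  ⨆ h : {h : E → ℝ // (∀ x, |h x| ≤ 1) ∧ LipschitzWith 1 h}, |∫ x, h.1 x ∂μ - ∫ x, h.1 x ∂ν|

end

end MannWhitney

/-! Given the data, `p⋆` is a linear combination of the i.i.d. multipliers: interchanging the sums
in the integrals defining it gives `p⋆ = ∑ D_q • weight_q` (`bootVector_eq_sum`), each weight being
a signed combination of centred placements. So the conditional law is that of a weighted i.i.d. sum,
and a central limit theorem applies once the weights are uniformly negligible and their Gram matrix
converges.

Negligibility is deterministic: placements are bounded by one, so the weights have order `N^(-1/2)`
(`abs_weight_le`). The Gram matrix is a fixed combination of empirical covariances of placements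
(`sum_weight_mul_weight`). These converge in probability to their population versions
(`tendsto_empCov`), because empirical distribution functions are consistent in mean at the sample
points and the law of large numbers handles the rest. The same combination of population covariances
is `Σ` (`limitCov_eq_sum_contrast`).

To pass from deterministic weights to convergence in probability without subsequences, convergence
in measure is expressed as convergence along a filter on `ι × Ω` (`inMeasure`), and the central
limit theorem is proved along arbitrary filters (`tendsto_dBL_map_sum_smul`). Finally, independence
of data and multipliers identifies the conditional distribution with the law obtained by freezing
the data (`condDistrib_bootVector`). -/

namespace MannWhitney

/-! ### Bounded Lipschitz distance and weak convergence -/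

section BoundedLipschitz

variable {E : Type*} [MeasurableSpace E]

lemma dBL_nonneg [PseudoEMetricSpace E] (μ ν : Measure E) : 0 ≤ dBL μ ν :=
  Real.iSup_nonneg fun _ => abs_nonneg _

variable [PseudoMetricSpace E] [OpensMeasurableSpace E]

/-- Layer-cake comparison for the nonnegative function `f = h + 1`. Since `f` is 1-Lipschitz, the
`ε`-thickening of `{t ≤ f}` lies in `{t ≤ f + ε}`, which costs one `ε`; the Lévy–Prokhorov error `ε
* ‖f‖` with `‖f‖ ≤ 2` costs two more. -/
lemma integral_sub_le_of_levyProkhorovEDist_lt (μ ν : Measure E) [IsProbabilityMeasure μ]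
    [IsProbabilityMeasure ν] {ε : ℝ} (hε : 0 < ε)
    (hμν : levyProkhorovEDist μ ν < ENNReal.ofReal ε) {h : E → ℝ} (hb : ∀ x, |h x| ≤ 1)
    (hL : LipschitzWith 1 h) : ∫ x, h x ∂μ - ∫ x, h x ∂ν ≤ 3 * ε := by
  have h_int (ρ : Measure E) [IsProbabilityMeasure ρ] : Integrable h ρ :=
    .of_bound hL.continuous.measurable.aestronglyMeasurable 1 (ae_of_all _ hb)
  let f : BoundedContinuousFunction E ℝ := BoundedContinuousFunction.ofNormedAddCommGroup
    (fun x => h x + 1) (hL.continuous.add continuous_const) 2 (fun x => by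
      have := abs_le.1 (hb x)
      rw [Real.norm_eq_abs, abs_le]; constructor <;> linarith)
  have hf (x : E) : f x = h x + 1 := rfl
  have f_nn (x : E) : 0 ≤ f x := by have := abs_le.1 (hb x); rw [hf]; linarith
  have f_norm : ‖f‖ ≤ 2 := BoundedContinuousFunction.norm_ofNormedAddCommGroup_le _ (by norm_num) _
  have key := BoundedContinuousFunction.integral_le_of_levyProkhorovEDist_lt μ ν hε hμν f
    (ae_of_all _ f_nn)
  have layer : ∫ x, (f x + ε) ∂ν
      = ∫ t in Set.Ioc 0 (‖f‖ + ε), ν.real {a : E | t ≤ f a + ε} := by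
    refine Integrable.integral_eq_integral_Ioc_meas_le ((f.integrable ν).add (integrable_const _))
      (ae_of_all _ fun x => add_nonneg (f_nn x) hε.le) (ae_of_all _ fun x => ?_)
    have := (le_abs_self _).trans (f.norm_coe_le_norm x)
    simpa using this
  have anti : Antitone fun t : ℝ => ν.real {a : E | t ≤ f a + ε} :=
    fun s t hst => measureReal_mono (fun x hx => hst.trans hx) (by finiteness)
  have anti' : Antitone fun t : ℝ => ν.real (Metric.thickening ε {a : E | t ≤ f a}) :=
    fun s t hst => measureReal_mono
      (Metric.thickening_subset_of_subset ε fun x hx => hst.trans hx) (by finiteness)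
  have int_on {g : ℝ → ℝ} (hg : Antitone g) (u : ℝ) : IntegrableOn g (Set.Ioc 0 u) :=
    ((hg.antitoneOn _).integrableOn_isCompact isCompact_Icc).mono_set Set.Ioc_subset_Icc_self
  have le1 : ∫ t in Set.Ioc 0 ‖f‖, ν.real (Metric.thickening ε {a | t ≤ f a})
      ≤ ∫ t in Set.Ioc 0 (‖f‖ + ε), ν.real {a : E | t ≤ f a + ε} := by
    calc _ ≤ ∫ t in Set.Ioc 0 ‖f‖, ν.real {a : E | t ≤ f a + ε} := by
          refine setIntegral_mono (int_on anti' _) (int_on anti _) fun t => ?_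
          refine measureReal_mono (fun x hx => ?_) (by finiteness)
          obtain ⟨z, hz, hxz⟩ := Metric.mem_thickening_iff.1 hx
          have h1 := hL.dist_le_mul z x
          rw [Real.dist_eq, dist_comm] at h1
          have h2 := (le_abs_self _).trans h1
          simp only [Set.mem_ofPred_eq, hf, NNReal.coe_one, one_mul] at hz h2 ⊢
          linarith
      _ ≤ _ := by
          refine setIntegral_mono_set (int_on anti _) (ae_of_all _ fun _ => measureReal_nonneg) ?_
          exact (Set.Ioc_subset_Ioc_right (by linarith)).eventuallyLE
  have e1 : ∫ x, f x ∂μ = ∫ x, h x ∂μ + 1 := by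
    simp_rw [hf]; rw [integral_add (h_int μ) (integrable_const _)]; simp
  have e2 : ∫ x, (f x + ε) ∂ν = ∫ x, h x ∂ν + 1 + ε := by
    simp_rw [hf, add_assoc]; rw [integral_add (h_int ν) (integrable_const _)]; simp
  have : ε * ‖f‖ ≤ ε * 2 := by gcongr
  linarith

lemma dBL_le_of_levyProkhorovEDist_lt (μ ν : Measure E) [IsProbabilityMeasure μ]
    [IsProbabilityMeasure ν] {ε : ℝ} (hε : 0 < ε)
    (hμν : levyProkhorovEDist μ ν < ENNReal.ofReal ε) : dBL μ ν ≤ 3 * ε := by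
  refine Real.iSup_le (fun h => ?_) (by positivity)
  rw [abs_le, neg_le, neg_sub]
  exact ⟨integral_sub_le_of_levyProkhorovEDist_lt ν μ hε
    (levyProkhorovEDist_comm μ ν ▸ hμν) h.2.1 h.2.2,
    integral_sub_le_of_levyProkhorovEDist_lt μ ν hε hμν h.2.1 h.2.2⟩

/-- Weak convergence implies convergence in the bounded Lipschitz distance. -/
lemma tendsto_dBL [TopologicalSpace.SeparableSpace E] {ι : Type*} {l : Filter ι}
    {μ : ι → ProbabilityMeasure E} {ν : ProbabilityMeasure E} (h : Tendsto μ l (𝓝 ν)) :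
    Tendsto (fun p => dBL (μ p : Measure E) (ν : Measure E)) l (𝓝 0) := by
  have h1 := (LevyProkhorov.continuous_ofMeasure_probabilityMeasure.tendsto ν).comp h
  rw [Metric.tendsto_nhds]
  intro ε hε
  filter_upwards [(EMetric.tendsto_nhds.1 h1) (ENNReal.ofReal (ε / 4))
    (ENNReal.ofReal_pos.2 (by positivity))] with p hp
  have := dBL_le_of_levyProkhorovEDist_lt (μ p : Measure E) (ν : Measure E)
    (by positivity : 0 < ε / 4) (by rwa [Function.comp_apply,
      LevyProkhorov.edist_probabilityMeasure_def] at hp)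
  rw [Real.dist_eq, sub_zero, abs_of_nonneg (dBL_nonneg _ _)]
  linarith

end BoundedLipschitz

/-! ### Central limit theorem for weighted i.i.d. sums -/

section WeightedCLT

/-- Exchange the factors one at a time; all the others have norm at most one. -/
lemma norm_prod_sub_prod_le_sum {κ : Type*} (S : Finset κ) (f g : κ → ℂ)
    (hf : ∀ k ∈ S, ‖f k‖ ≤ 1) (hg : ∀ k ∈ S, ‖g k‖ ≤ 1) :
    ‖∏ k ∈ S, f k - ∏ k ∈ S, g k‖ ≤ ∑ k ∈ S, ‖f k - g k‖ := by
  classical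
  induction S using Finset.induction_on with
  | empty => simp
  | insert k S hk ih =>
    rw [Finset.prod_insert hk, Finset.prod_insert hk, Finset.sum_insert hk]
    have ih := ih (fun j hj => hf j (Finset.mem_insert_of_mem hj))
      (fun j hj => hg j (Finset.mem_insert_of_mem hj))
    have h1 : ‖∏ j ∈ S, f j‖ ≤ 1 := by
      rw [norm_prod]
      exact Finset.prod_le_one (fun _ _ => norm_nonneg _)
        fun j hj => hf j (Finset.mem_insert_of_mem hj)
    have h2 := hg k (Finset.mem_insert_self _ _)
    calc ‖f k * ∏ j ∈ S, f j - g k * ∏ j ∈ S, g j‖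
        = ‖(f k - g k) * ∏ j ∈ S, f j + g k * (∏ j ∈ S, f j - ∏ j ∈ S, g j)‖ := by
          congr 1; ring
      _ ≤ ‖f k - g k‖ * ‖∏ j ∈ S, f j‖ + ‖g k‖ * ‖∏ j ∈ S, f j - ∏ j ∈ S, g j‖ := by
          refine (norm_add_le _ _).trans ?_
          rw [norm_mul, norm_mul]
      _ ≤ ‖f k - g k‖ * 1 + 1 * ∑ j ∈ S, ‖f j - g j‖ := by gcongr
      _ = _ := by ring

/-- The characteristic function of a standardized law agrees with that of the standard normal law
up to second order at the origin. -/
lemma charFun_sub_exp_isLittleO {ρ : Measure ℝ} [IsProbabilityMeasure ρ]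
    (h0 : ∫ x, x ∂ρ = 0) (h1 : ∫ x, x ^ 2 ∂ρ = 1) :
    (fun t : ℝ => charFun ρ t - Complex.exp (-(t : ℂ) ^ 2 / 2)) =o[𝓝 0] fun t => t ^ 2 := by
  have hρ := taylor_charFun_two (P := ρ) (X := id) aemeasurable_id (by simpa using h0)
    (by simpa using h1)
  have hγ := taylor_charFun_two (P := gaussianReal 0 1) (X := id) aemeasurable_id
    (by simp) (by
      have := variance_of_integral_eq_zero (X := id) (μ := gaussianReal 0 1) aemeasurable_id
        (by simp)
      simpa using this.symm)
  refine (hρ.sub hγ).congr_left fun t => ?_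
  simp [charFun_gaussianReal, neg_div]

/-- Uniform smallness puts every `b p k` into the neighbourhood of zero where the factor differs
from its Gaussian counterpart by at most a small multiple of `b p k ^ 2`. By the telescoping bound
the products then differ by that multiple of `∑ b p k ^ 2`, which stays bounded. -/
lemma tendsto_prod_charFun {ρ : Measure ℝ} [IsProbabilityMeasure ρ]
    (h0 : ∫ x, x ∂ρ = 0) (h1 : ∫ x, x ^ 2 ∂ρ = 1) {ι κ : Type*} {l : Filter ι}
    {S : ι → Finset κ} {b : ι → κ → ℝ} {β : ι → ℝ} (hb : ∀ p, ∀ k ∈ S p, |b p k| ≤ β p)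
    (hβ : Tendsto β l (𝓝 0)) {s : ℝ} (hs : Tendsto (fun p => ∑ k ∈ S p, b p k ^ 2) l (𝓝 s)) :
    Tendsto (fun p => ∏ k ∈ S p, charFun ρ (b p k)) l (𝓝 (Complex.exp (-(s : ℂ) / 2))) := by
  have hexp : Tendsto (fun p => ∏ k ∈ S p, Complex.exp (-(b p k : ℂ) ^ 2 / 2)) l
      (𝓝 (Complex.exp (-(s : ℂ) / 2))) := by
    have h2 : Tendsto (fun p => Complex.exp (-((∑ k ∈ S p, b p k ^ 2 : ℝ) : ℂ) / 2)) l
        (𝓝 (Complex.exp (-(s : ℂ) / 2))) := by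
      have hc : Continuous fun u : ℝ => Complex.exp (-(u : ℂ) / 2) := by fun_prop
      exact (hc.tendsto s).comp hs
    refine h2.congr fun p => ?_
    rw [← Complex.exp_sum]
    congr 1
    push_cast
    rw [← Finset.sum_neg_distrib, Finset.sum_div]
  suffices h : Tendsto (fun p => ∏ k ∈ S p, charFun ρ (b p k)
      - ∏ k ∈ S p, Complex.exp (-(b p k : ℂ) ^ 2 / 2)) l (𝓝 0) by
    simpa using h.add hexp
  rw [Metric.tendsto_nhds]
  intro ε hε
  have hs0 : 0 < |s| + 1 := by positivity
  have hlo := (charFun_sub_exp_isLittleO h0 h1).def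
    (show 0 < ε / 2 / (|s| + 1) by positivity)
  obtain ⟨δ, hδ, hball⟩ := Metric.eventually_nhds_iff.1 hlo
  filter_upwards [hβ.eventually_lt_const hδ,
    hs.eventually_lt_const (show s < |s| + 1 by linarith [le_abs_self s])] with p hp1 hp2
  rw [dist_zero_right]
  calc _ ≤ ∑ k ∈ S p, ‖charFun ρ (b p k) - Complex.exp (-(b p k : ℂ) ^ 2 / 2)‖ := by
        refine norm_prod_sub_prod_le_sum _ _ _ (fun k _ => norm_charFun_le_one _) fun k _ => ?_
        rw [Complex.norm_exp, Real.exp_le_one_iff]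
        rw [show (-(b p k : ℂ) ^ 2 / 2) = ((-(b p k) ^ 2 / 2 : ℝ) : ℂ) by push_cast; ring,
          Complex.ofReal_re]
        nlinarith [sq_nonneg (b p k)]
    _ ≤ ∑ k ∈ S p, ε / 2 / (|s| + 1) * b p k ^ 2 := by
        refine Finset.sum_le_sum fun k hk => ?_
        have := hball (y := b p k) (by
          rw [dist_zero_right, Real.norm_eq_abs]; exact (hb p k hk).trans_lt hp1)
        simpa using this
    _ = ε / 2 / (|s| + 1) * ∑ k ∈ S p, b p k ^ 2 := by rw [Finset.mul_sum]
    _ ≤ ε / 2 / (|s| + 1) * (|s| + 1) := by gcongr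
    _ < ε := by rw [div_mul_cancel₀ _ hs0.ne']; linarith

variable {Ω : Type*} [MeasurableSpace Ω] {P : Measure Ω} {ι κ τ : Type*} [Fintype τ]

/-- The value at `t` of the characteristic function of a weighted sum of i.i.d. variables. -/
lemma charFun_map_sum_smul {D : κ → Ω → ℝ} (hD : ∀ k, Measurable (D k)) (hind : iIndepFun D P)
    {ρ : Measure ℝ} (hρ : ∀ k, P.map (D k) = ρ) (S : Finset κ) (v : κ → EuclideanSpace ℝ τ)
    (t : EuclideanSpace ℝ τ) :
    charFun (P.map fun ω => ∑ k ∈ S, D k ω • v k) t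
      = ∏ k ∈ S, charFun ρ (inner ℝ (v k) t) := by
  rw [iIndepFun.charFun_map_fun_finsetSum_eq_prod (X := fun k ω => D k ω • v k)
    (fun k _ => ((hD k).smul_const (v k)).aemeasurable), Finset.prod_apply]
  · refine Finset.prod_congr rfl fun k _ => ?_
    have h1 : Measurable fun x : ℝ => x • v k := measurable_id.smul_const _
    rw [← hρ k, charFun_apply, charFun_apply_real, integral_map (by fun_prop) (by fun_prop),
      integral_map (by fun_prop) (by fun_prop)]
    refine integral_congr_ae (ae_of_all _ fun ω => ?_)
    simp only [real_inner_smul_left]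
    push_cast
    ring_nf
  · exact (hind.precomp (g := ((↑) : S → κ)) Subtype.val_injective).comp
      (fun k x => x • v k) fun k => measurable_id.smul_const _

lemma sum_inner_sq (S : Finset κ) (v : κ → EuclideanSpace ℝ τ) (t : EuclideanSpace ℝ τ) :
    ∑ k ∈ S, inner ℝ (v k) t ^ 2 = ∑ s, ∑ s', t s * t s' * ∑ k ∈ S, v k s * v k s' := by
  simp_rw [PiLp.inner_apply, sq, Finset.sum_mul_sum, Finset.mul_sum]
  rw [Finset.sum_comm]
  refine Finset.sum_congr rfl fun s _ => ?_
  rw [Finset.sum_comm]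
  refine Finset.sum_congr rfl fun s' _ => Finset.sum_congr rfl fun k _ => ?_
  simp only [RCLike.inner_apply, conj_trivial]
  ring

variable [DecidableEq τ]

lemma tendsto_map_sum_smul {D : κ → Ω → ℝ} (hD : ∀ k, Measurable (D k)) (hind : iIndepFun D P)
    {ρ : Measure ℝ} (hρ : ∀ k, P.map (D k) = ρ) [IsProbabilityMeasure ρ]
    (h0 : ∫ x, x ∂ρ = 0) (h1 : ∫ x, x ^ 2 ∂ρ = 1) {l : Filter ι} [l.IsCountablyGenerated]
    {S : ι → Finset κ} {v : ι → κ → EuclideanSpace ℝ τ} {β : ι → ℝ}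
    (hv : ∀ p, ∀ k ∈ S p, ∀ s, |v p k s| ≤ β p) (hβ : Tendsto β l (𝓝 0))
    {C : Matrix τ τ ℝ} (hC : C.PosSemidef)
    (hcov : Tendsto (fun p s s' => ∑ k ∈ S p, v p k s * v p k s') l (𝓝 fun s s' => C s s'))
    {μ : ι → ProbabilityMeasure (EuclideanSpace ℝ τ)}
    (hμ : ∀ p, (μ p : Measure (EuclideanSpace ℝ τ)) = P.map fun ω => ∑ k ∈ S p, D k ω • v p k)
    {ν : ProbabilityMeasure (EuclideanSpace ℝ τ)}
    (hν : (ν : Measure (EuclideanSpace ℝ τ)) = multivariateGaussian 0 C) :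
    Tendsto μ l (𝓝 ν) := by
  -- Lévy's continuity theorem is applied to sequences, hence the countably generated filter.
  refine tendsto_of_seq_tendsto fun u hu => ?_
  refine ProbabilityMeasure.tendsto_of_tendsto_charFun fun t => ?_
  simp only [Function.comp_apply]
  simp_rw [hμ, hν, charFun_map_sum_smul hD hind hρ]
  have hlim : charFun (multivariateGaussian 0 C) t
      = Complex.exp (-((∑ s, ∑ s', t s * t s' * C s s' : ℝ) : ℂ) / 2) := by
    rw [charFun_multivariateGaussian hC, inner_zero_right, Complex.ofReal_zero, zero_mul, zero_sub,
      neg_div]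
    congr 4
    simp only [dotProduct, Matrix.mulVec, Finset.mul_sum]
    exact Finset.sum_congr rfl fun s _ => Finset.sum_congr rfl fun s' _ => by ring
  rw [hlim]
  refine tendsto_prod_charFun h0 h1 (β := fun r => β (u r) * ∑ s, |t s|) (fun r k hk => ?_) ?_ ?_
  · rw [PiLp.inner_apply]
    refine (Finset.abs_sum_le_sum_abs _ _).trans ?_
    rw [Finset.mul_sum]
    refine Finset.sum_le_sum fun s _ => ?_
    simp only [RCLike.inner_apply, conj_trivial, abs_mul]
    rw [mul_comm]
    gcongr
    exact hv _ _ hk _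
  · simpa using (hβ.comp hu).mul_const (∑ s, |t s|)
  · simp_rw [sum_inner_sq]
    refine tendsto_finsetSum _ fun s _ => tendsto_finsetSum _ fun s' _ => Tendsto.const_mul _ ?_
    exact (tendsto_pi_nhds.1 (tendsto_pi_nhds.1 (hcov.comp hu) s) s')

variable [IsProbabilityMeasure P]

/-- Central limit theorem for weighted sums of i.i.d. standardized variables with uniformly
negligible weights, along an arbitrary filter. -/
lemma tendsto_dBL_map_sum_smul {D : κ → Ω → ℝ} (hD : ∀ k, Measurable (D k))
    (hind : iIndepFun D P) {ρ : Measure ℝ} (hρ : ∀ k, P.map (D k) = ρ) [IsProbabilityMeasure ρ]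
    (h0 : ∫ x, x ∂ρ = 0) (h1 : ∫ x, x ^ 2 ∂ρ = 1) {l : Filter ι}
    {S : ι → Finset κ} {v : ι → κ → EuclideanSpace ℝ τ} {β : ι → ℝ}
    (hv : ∀ p, ∀ k ∈ S p, ∀ s, |v p k s| ≤ β p) (hβ : Tendsto β l (𝓝 0))
    {C : Matrix τ τ ℝ} (hC : C.PosSemidef)
    (hcov : Tendsto (fun p s s' => ∑ k ∈ S p, v p k s * v p k s') l (𝓝 fun s s' => C s s')) :
    Tendsto (fun p => dBL (P.map fun ω => ∑ k ∈ S p, D k ω • v p k) (multivariateGaussian 0 C))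
      l (𝓝 0) := by
  have hm (p : ι) : IsProbabilityMeasure (P.map fun ω => ∑ k ∈ S p, D k ω • v p k) :=
    Measure.isProbabilityMeasure_map
      (Finset.measurable_sum _ fun k _ => (hD k).smul_const _).aemeasurable
  -- Only the bound `β` and the Gram matrix matter. The pullback under `Φ` of the neighbourhoods of
  -- their limit is countably generated and coarser than `l`, so it suffices to prove convergence
  -- along it.
  let Φ : ι → ℝ × (τ → τ → ℝ) := fun p => (β p, fun s s' => ∑ k ∈ S p, v p k s * v p k s')
  have hΦ : Tendsto Φ (comap Φ (𝓝 (0, fun s s' => C s s'))) (𝓝 (0, fun s s' => C s s')) :=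
    tendsto_comap
  have key := tendsto_map_sum_smul hD hind hρ h0 h1 (l := comap Φ (𝓝 (0, fun s s' => C s s')))
    hv ((continuous_fst.tendsto _).comp hΦ) hC ((continuous_snd.tendsto _).comp hΦ)
    (μ := fun p => ⟨_, hm p⟩) (fun _ => rfl) (ν := ⟨multivariateGaussian 0 C, inferInstance⟩) rfl
  exact (tendsto_dBL key).mono_left (hβ.prodMk_nhds hcov).le_comap

end WeightedCLT

/-! ### The bootstrap vector as a linear form in the multipliers -/

section Representation

variable {a d : ℕ}

/-- The average of `g` over the observation vectors of group `l`. -/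
noncomputable def empMean (n : Fin a → ℕ) (x : Fin a → ℕ → Fin d → ℝ) (l : Fin a)
    (g : (Fin d → ℝ) → ℝ) : ℝ :=
  1 / (n l : ℝ) * ∑ k ∈ Finset.range (n l), g (x l k)

/-- The centred placement `∫ F̂_{ij} dF̂_{lj} - F̂_{ij}(X_{ljk})`. -/
noncomputable def placement (n : Fin a → ℕ) (x : Fin a → ℕ → Fin d → ℝ) (i l : Fin a) (j : Fin d)
    (k : ℕ) : ℝ :=
  empIntegral n x l j (empCDF n x i j) - empCDF n x i j (x l k j)

/-- The coefficient of the `i'`-placement of group `l` in the effect of group `i`. -/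
def contrast (i l i' : Fin a) : ℝ := (if i = i' then 1 else 0) - (if i = l then 1 else 0)

/-- The vector multiplying the multiplier of individual `k` in group `l` in the wild bootstrap
effect vector. -/
noncomputable def weight (n : Fin a → ℕ) (x : Fin a → ℕ → Fin d → ℝ) (q : (_ : Fin a) × ℕ) :
    EuclideanSpace ℝ (Fin a × Fin d) :=
  WithLp.toLp 2 fun s => √(totalSize n : ℝ) / (a * n q.1)
    * ∑ i', contrast s.1 q.1 i' * placement n x i' q.1 s.2 q.2

/-- The observed individuals. -/
def individuals (n : Fin a → ℕ) : Finset ((_ : Fin a) × ℕ) :=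
  Finset.univ.sigma fun l => Finset.range (n l)

/-- The empirical counterpart of `crossCov`. -/
noncomputable def empCov (n : Fin a → ℕ) (x : Fin a → ℕ → Fin d → ℝ) (i i' l : Fin a)
    (j j' : Fin d) : ℝ :=
  empMean n x l (fun y => empCDF n x i j (y j) * empCDF n x i' j' (y j'))
    - empIntegral n x l j (empCDF n x i j) * empIntegral n x l j' (empCDF n x i' j')

lemma cFun_add_cFun_neg (u : ℝ) : cFun u + cFun (-u) = 1 := by
  unfold cFun
  rcases lt_trichotomy u 0 with h | h | h
  · simp [h, h.not_gt, h.ne]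
  · subst h; norm_num
  · simp [h, h.not_gt, h.ne']

lemma cFun_nonneg (u : ℝ) : 0 ≤ cFun u := by
  unfold cFun; positivity

lemma cFun_le_one (u : ℝ) : cFun u ≤ 1 := by
  have := cFun_add_cFun_neg u
  linarith [cFun_nonneg (-u)]

variable {n : Fin a → ℕ} (x : Fin a → ℕ → Fin d → ℝ)

lemma average_cFun_sub (i : Fin a) (hi : 0 < n i) (j : Fin d) (t : ℝ) :
    1 / (n i : ℝ) * ∑ k ∈ Finset.range (n i), cFun (x i k j - t) = 1 - empCDF n x i j t := by
  have h (k : ℕ) : cFun (x i k j - t) = 1 - cFun (t - x i k j) := by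
    rw [← cFun_add_cFun_neg (t - x i k j), neg_sub]; ring
  have hi' : (n i : ℝ) ≠ 0 := by positivity
  simp_rw [h, Finset.sum_sub_distrib, mul_sub, empCDF]
  simp [hi']

/-- Average `c(u) + c(-u) = 1` over all pairs of observations from the two groups; ties are covered
by the value `1/2` at zero. -/
lemma empIntegral_empCDF_swap (i l : Fin a) (hi : 0 < n i) (hl : 0 < n l) (j : Fin d) :
    empIntegral n x i j (empCDF n x l j) = 1 - empIntegral n x l j (empCDF n x i j) := by
  have hl' : (n l : ℝ) ≠ 0 := by positivity
  have h : 1 - empIntegral n x l j (empCDF n x i j)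
      = 1 / (n l : ℝ) * ∑ k ∈ Finset.range (n l), (1 - empCDF n x i j (x l k j)) := by
    simp_rw [Finset.sum_sub_distrib, mul_sub, empIntegral]
    simp [hl']
  rw [h]
  simp_rw [← average_cFun_sub x i hi j, empIntegral, empCDF, Finset.mul_sum]
  rw [Finset.sum_comm]
  exact Finset.sum_congr rfl fun k _ => Finset.sum_congr rfl fun q _ => by ring

/-- After interchanging the sums, the coefficient of `m l k` is the `F̂_{ij}`-integral of `c(t -
X_{ljk}) - F̂_{lj}(t)`. Reflection turns it into `1 - F̂_{ij}(X_{ljk}) - ∫ F̂_{lj} dF̂_{ij}`, and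
the swap identity makes this the placement. -/
lemma empIntegral_bootCDF (m : Fin a → ℕ → ℝ) (i l : Fin a) (hi : 0 < n i) (hl : 0 < n l)
    (j : Fin d) : empIntegral n x i j (bootCDF n x m l j)
      = 1 / (n l : ℝ) * ∑ k ∈ Finset.range (n l), m l k * placement n x i l j k := by
  have h (k : ℕ) : placement n x i l j k = 1 / (n i : ℝ) * ∑ q ∈ Finset.range (n i),
      (cFun (x i q j - x l k j) - empCDF n x l j (x i q j)) := by
    rw [Finset.sum_sub_distrib, mul_sub, average_cFun_sub x i hi j]
    have := empIntegral_empCDF_swap x i l hi hl j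
    rw [placement]
    rw [empIntegral] at this
    linarith
  simp_rw [h, empIntegral, bootCDF, Finset.mul_sum]
  rw [Finset.sum_comm]
  exact Finset.sum_congr rfl fun k _ => Finset.sum_congr rfl fun q _ => by ring

lemma sum_contrast_mul (i l : Fin a) (f : Fin a → ℝ) :
    ∑ i', contrast i l i' * f i' = f i - if i = l then ∑ i', f i' else 0 := by
  simp_rw [contrast, sub_mul, Finset.sum_sub_distrib, ite_mul, one_mul, zero_mul]
  split_ifs <;> simp

/-- The integral of `G⋆` involves the multipliers of every group `l`, each with the `i`-placement;
the integral of `F⋆_i` involves only group `i`, with all its placements. These are the two terms of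
`contrast`. -/
lemma bootVector_eq_sum (hn : ∀ i, 0 < n i) (m : Fin a → ℕ → ℝ) :
    bootVector n x m = ∑ q ∈ individuals n, m q.1 q.2 • weight n x q := by
  ext s
  simp only [bootVector, WithLp.ofLp_sum, WithLp.ofLp_smul, Finset.sum_apply, Pi.smul_apply,
    smul_eq_mul, weight, individuals, Finset.sum_sigma, sum_contrast_mul]
  have h1 : empIntegral n x s.1 s.2 (bootMeanCDF n x m s.2)
      = 1 / (a : ℝ) * ∑ l, empIntegral n x s.1 s.2 (bootCDF n x m l s.2) := by
    simp_rw [empIntegral, bootMeanCDF, Finset.mul_sum]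
    rw [Finset.sum_comm]
    exact Finset.sum_congr rfl fun k _ => Finset.sum_congr rfl fun q _ => by ring
  have h2 : ∑ l, empIntegral n x l s.2 (bootCDF n x m s.1 s.2)
      = ∑ l, if s.1 = l then 1 / (n l : ℝ) * ∑ k ∈ Finset.range (n l),
        m l k * ∑ i', placement n x i' l s.2 k else 0 := by
    rw [Finset.sum_ite_eq, if_pos (Finset.mem_univ _)]
    simp_rw [empIntegral_bootCDF x m _ _ (hn _) (hn _), Finset.mul_sum]
    rw [Finset.sum_comm]
  rw [bootEffect, h1, h2]
  simp_rw [empIntegral_bootCDF x m _ _ (hn _) (hn _)]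
  rw [← mul_sub, ← Finset.sum_sub_distrib, Finset.mul_sum, Finset.mul_sum]
  refine Finset.sum_congr rfl fun l _ => ?_
  split_ifs
  · rw [← mul_sub, ← Finset.sum_sub_distrib, ← mul_assoc, ← mul_assoc, Finset.mul_sum]
    exact Finset.sum_congr rfl fun k _ => by ring
  · rw [sub_zero]
    simp_rw [Finset.mul_sum]
    exact Finset.sum_congr rfl fun k _ => by ring

/-- Placements are centred at their sample mean, so their mean product is an empirical covariance.
-/
lemma empMean_placement_mul_placement (i i' l : Fin a) (hl : 0 < n l) (j j' : Fin d) :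
    1 / (n l : ℝ) * ∑ k ∈ Finset.range (n l), placement n x i l j k * placement n x i' l j' k
      = empCov n x i i' l j j' := by
  have hl' : (n l : ℝ) ≠ 0 := by positivity
  have e1 : 1 / (n l : ℝ) * ∑ k ∈ Finset.range (n l), empCDF n x i j (x l k j)
    = empIntegral n x l j (empCDF n x i j) := rfl
  have e2 : 1 / (n l : ℝ) * ∑ k ∈ Finset.range (n l), empCDF n x i' j' (x l k j')
    = empIntegral n x l j' (empCDF n x i' j') := rfl
  simp only [placement, empCov, empMean]
  generalize empIntegral n x l j (empCDF n x i j) = A at *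
  generalize empIntegral n x l j' (empCDF n x i' j') = B at *
  have (k : ℕ) : (A - empCDF n x i j (x l k j)) * (B - empCDF n x i' j' (x l k j'))
      = empCDF n x i j (x l k j) * empCDF n x i' j' (x l k j') + A * B
        - A * empCDF n x i' j' (x l k j') - B * empCDF n x i j (x l k j) := by ring
  simp_rw [this, Finset.sum_sub_distrib, Finset.sum_add_distrib, ← Finset.mul_sum]
  rw [Finset.sum_const, Finset.card_range, nsmul_eq_mul]
  have e3 : 1 / (n l : ℝ) * (n l * (A * B)) = A * B := by field_simp
  linear_combination e3 - A * e2 - B * e1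

lemma sum_weight_mul_weight (hn : ∀ i, 0 < n i) (s s' : Fin a × Fin d) :
    ∑ q ∈ individuals n, weight n x q s * weight n x q s'
      = ∑ l, (totalSize n : ℝ) / n l * (1 / (a : ℝ) ^ 2 * ∑ i, ∑ i',
        contrast s.1 l i * contrast s'.1 l i' * empCov n x i i' l s.2 s'.2) := by
  simp only [weight, individuals, Finset.sum_sigma]
  refine Finset.sum_congr rfl fun l _ => ?_
  simp_rw [← empMean_placement_mul_placement x _ _ l (hn l)]
  have hN : √(totalSize n : ℝ) * √(totalSize n : ℝ) = totalSize n :=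
    Real.mul_self_sqrt (Nat.cast_nonneg _)
  have h (k : ℕ) : √(totalSize n : ℝ) / (a * n l) *
        (∑ i', contrast s.1 l i' * placement n x i' l s.2 k) *
      (√(totalSize n : ℝ) / (a * n l) * ∑ i', contrast s'.1 l i' * placement n x i' l s'.2 k)
      = (totalSize n : ℝ) / n l * (1 / (a : ℝ) ^ 2) * (1 / n l) * ∑ i, ∑ i',
        contrast s.1 l i * contrast s'.1 l i'
          * (placement n x i l s.2 k * placement n x i' l s'.2 k) := by
    rw [mul_mul_mul_comm, div_mul_div_comm, hN, Finset.sum_mul_sum]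
    congr 1
    · ring
    · exact Finset.sum_congr rfl fun i _ => Finset.sum_congr rfl fun i' _ => by ring
  simp_rw [h, Finset.mul_sum]
  rw [Finset.sum_comm]
  refine Finset.sum_congr rfl fun i _ => ?_
  rw [Finset.sum_comm]
  exact Finset.sum_congr rfl fun i' _ => Finset.sum_congr rfl fun k _ => by ring

/-- The four Kronecker terms of `sigma` are the four products in the expansion of the two contrasts.
In this form `Σ` matches the Gram matrix of the weights term by term. -/
lemma limitCov_eq_sum_contrast (Q : Fin a → Measure (Fin d → ℝ)) (lam : Fin a → ℝ)
    (s s' : Fin a × Fin d) :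
    limitCov Q lam s s' = ∑ l, 1 / lam l * (1 / (a : ℝ) ^ 2 * ∑ i, ∑ i',
        contrast s.1 l i * contrast s'.1 l i' * crossCov Q i i' l s.2 s'.2) := by
  have h (l : Fin a) : ∑ i, ∑ i', contrast s.1 l i * contrast s'.1 l i'
        * crossCov Q i i' l s.2 s'.2
      = crossCov Q s.1 s'.1 l s.2 s'.2
        - (if s'.1 = l then ∑ i', crossCov Q s.1 i' l s.2 s'.2 else 0)
        - (if s.1 = l then ∑ i, (crossCov Q i s'.1 l s.2 s'.2
          - if s'.1 = l then ∑ i', crossCov Q i i' l s.2 s'.2 else 0) else 0) := by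
    simp_rw [mul_assoc, ← Finset.mul_sum, sum_contrast_mul]
  simp_rw [h, mul_left_comm _ (1 / (a : ℝ) ^ 2), ← Finset.mul_sum]
  simp only [limitCov, Matrix.of_apply, sigma, Finset.sum_sub_distrib, Finset.sum_add_distrib,
    mul_sub, mul_ite, mul_zero, Finset.sum_ite_eq, Finset.mem_univ, if_true]
  have e : ∑ l, ∑ i', (if l = s'.1 then 1 / lam l * crossCov Q s.1 i' l s.2 s'.2 else 0)
      = 1 / lam s'.1 * ∑ i', crossCov Q s.1 i' s'.1 s.2 s'.2 := by
    rw [Finset.sum_comm, Finset.mul_sum]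
    exact Finset.sum_congr rfl fun i' _ => by rw [Finset.sum_ite_eq', if_pos (Finset.mem_univ _)]
  rw [e]
  by_cases hs : s.1 = s'.1
  · simp only [hs, if_true, ← Finset.mul_sum]
    ring
  · simp only [hs, Ne.symm hs, if_false, ← Finset.mul_sum, Finset.sum_const_zero]
    ring

lemma empCDF_nonneg (i : Fin a) (j : Fin d) (t : ℝ) : 0 ≤ empCDF n x i j t :=
  mul_nonneg (by positivity) (Finset.sum_nonneg fun _ _ => cFun_nonneg _)

lemma average_le_one {N : ℕ} {f : ℕ → ℝ} (hf : ∀ k, f k ≤ 1) :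
    1 / (N : ℝ) * ∑ k ∈ Finset.range N, f k ≤ 1 := by
  rcases N.eq_zero_or_pos with rfl | hN
  · simp
  rw [one_div_mul_eq_div, div_le_one (by positivity)]
  simpa using Finset.sum_le_card_nsmul (Finset.range N) f 1 fun k _ => hf k

lemma empCDF_le_one (i : Fin a) (j : Fin d) (t : ℝ) : empCDF n x i j t ≤ 1 :=
  average_le_one fun _ => cFun_le_one _

lemma abs_placement_le_one (i l : Fin a) (j : Fin d) (k : ℕ) : |placement n x i l j k| ≤ 1 := by
  have h1 : 0 ≤ empIntegral n x l j (empCDF n x i j) :=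
    mul_nonneg (by positivity) (Finset.sum_nonneg fun _ _ => empCDF_nonneg x _ _ _)
  have h2 : empIntegral n x l j (empCDF n x i j) ≤ 1 := average_le_one fun _ => empCDF_le_one x _ _ _
  have h3 := empCDF_nonneg (n := n) x i j (x l k j)
  have h4 := empCDF_le_one (n := n) x i j (x l k j)
  rw [placement, abs_le]
  constructor <;> linarith

/-- The `a` summands are at most one in absolute value and cancel the factor `1 / a`. Summing over
all groups makes the bound independent of the individual. -/
lemma abs_weight_le (q : (_ : Fin a) × ℕ) (s : Fin a × Fin d) :
    |weight n x q s| ≤ ∑ l, √(totalSize n : ℝ) / n l := by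
  have hq : |∑ i', contrast s.1 q.1 i' * placement n x i' q.1 s.2 q.2| ≤ a := by
    refine (Finset.abs_sum_le_sum_abs _ _).trans ?_
    have : ∀ i' ∈ Finset.univ, |contrast s.1 q.1 i' * placement n x i' q.1 s.2 q.2| ≤ 1 := by
      intro i' _
      rw [abs_mul]
      refine mul_le_one₀ ?_ (abs_nonneg _) (abs_placement_le_one x _ _ _ _)
      unfold contrast
      split_ifs <;> norm_num
    simpa using Finset.sum_le_card_nsmul _ _ 1 this
  have ha : 0 < (a : ℝ) := by exact_mod_cast (Fin.pos q.1)
  calc |weight n x q s| ≤ √(totalSize n : ℝ) / (a * n q.1) * a := by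
        simp only [weight, abs_mul]
        rw [abs_of_nonneg (by positivity : 0 ≤ √(totalSize n : ℝ) / (a * n q.1))]
        gcongr
    _ = √(totalSize n : ℝ) / n q.1 := by
        rw [div_mul_eq_mul_div, mul_comm (a : ℝ) (n q.1 : ℝ), mul_div_mul_right _ _ ha.ne']
    _ ≤ _ := Finset.single_le_sum (f := fun l => √(totalSize n : ℝ) / n l)
        (fun _ _ => by positivity) (Finset.mem_univ q.1)

end Representation

/-! ### Convergence in measure as convergence along a filter -/

section InMeasure

variable {Ω ι : Type*} [MeasurableSpace Ω]

/-- The filter on `ι × Ω` along which convergence is convergence in (outer) measure. -/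
def inMeasure (P : Measure Ω) (u : Filter ι) : Filter (ι × Ω) where
  sets := {S | Tendsto (fun r => P {ω | (r, ω) ∉ S}) u (𝓝 0)}
  univ_sets := by simpa using tendsto_const_nhds
  sets_of_superset {S T} hS hST := by
    refine tendsto_of_tendsto_of_tendsto_of_le_of_le tendsto_const_nhds hS (fun _ => zero_le)
      fun r => measure_mono fun ω hω h => hω (hST h)
  inter_sets {S T} hS hT := by
    have h := Tendsto.add hS hT
    rw [add_zero] at h
    refine tendsto_of_tendsto_of_tendsto_of_le_of_le tendsto_const_nhds h (fun _ => zero_le)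
      fun r => (measure_mono fun ω hω => ?_).trans (measure_union_le _ _)
    by_cases h1 : (r, ω) ∈ S
    · exact Or.inr fun h2 => hω ⟨h1, h2⟩
    · exact Or.inl h1

lemma mem_inMeasure {P : Measure Ω} {u : Filter ι} {S : Set (ι × Ω)} :
    S ∈ inMeasure P u ↔ Tendsto (fun r => P {ω | (r, ω) ∉ S}) u (𝓝 0) := Iff.rfl

/-- Makes the algebra of limits, squeezing and eventual equality available for convergence in
probability, with no measurability needed. -/
lemma tendstoInMeasure_const_iff {P : Measure Ω} {u : Filter ι} {E : Type*} [PseudoMetricSpace E]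
    {f : ι → Ω → E} {c : E} : TendstoInMeasure P f u (fun _ => c) ↔
      Tendsto (fun p : ι × Ω => f p.1 p.2) (inMeasure P u) (𝓝 c) := by
  rw [tendstoInMeasure_iff_dist, Metric.tendsto_nhds]
  refine forall₂_congr fun ε _ => ?_
  rw [Filter.Eventually, mem_inMeasure]
  simp only [Set.mem_ofPred_eq, not_lt]

lemma tendsto_fst_inMeasure (P : Measure Ω) (u : Filter ι) :
    Tendsto Prod.fst (inMeasure P u) u := by
  intro S hS
  rw [Filter.mem_map, mem_inMeasure]
  refine tendsto_const_nhds.congr' ?_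
  filter_upwards [hS] with r hr
  simp [hr]

/-- Gives uniqueness of limits in probability and preservation of inequalities, from which `Σ`
inherits symmetry and positivity. -/
lemma inMeasure_neBot (P : Measure Ω) [IsProbabilityMeasure P] (u : Filter ι) [u.NeBot] :
    (inMeasure P u).NeBot := by
  rw [Filter.neBot_iff, Ne, ← Filter.empty_mem_iff_bot, mem_inMeasure]
  intro h
  simp only [Set.mem_empty_iff_false, not_false_eq_true, Set.ofPred_true, measure_univ] at h
  exact one_ne_zero (tendsto_nhds_unique tendsto_const_nhds h)

end InMeasure

/-! ### Normalized distribution functions -/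

section Population

variable {a d : ℕ} (Q : Fin a → Measure (Fin d → ℝ))

lemma measurable_cFun : Measurable cFun := by
  unfold cFun
  exact (Measurable.ite measurableSet_Ioi measurable_const measurable_const).add
    (Measurable.ite (measurableSet_singleton 0) measurable_const measurable_const)

lemma integrable_cFun_sub (i : Fin a) [IsProbabilityMeasure (Q i)] (j : Fin d) (t : ℝ) :
    Integrable (fun y : Fin d → ℝ => cFun (t - y j)) (Q i) := by
  refine .of_bound (measurable_cFun.comp (by fun_prop)).aestronglyMeasurable 1
    (ae_of_all _ fun y => ?_)
  rw [Real.norm_eq_abs, abs_of_nonneg (cFun_nonneg _)]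
  exact cFun_le_one _

lemma normCDF_eq_integral (i : Fin a) [IsProbabilityMeasure (Q i)] (j : Fin d) (t : ℝ) :
    normCDF Q i j t = ∫ y, cFun (t - y j) ∂(Q i) := by
  have hj : Measurable fun y : Fin d → ℝ => y j := measurable_pi_apply j
  have h (y : Fin d → ℝ) : cFun (t - y j)
      = ((fun y : Fin d → ℝ => y j) ⁻¹' Set.Iio t).indicator (fun _ => (1 / 2 : ℝ)) y
        + ((fun y : Fin d → ℝ => y j) ⁻¹' Set.Iic t).indicator (fun _ => (1 / 2 : ℝ)) y := by
    simp only [cFun, Set.indicator, Set.mem_preimage, Set.mem_Iio, Set.mem_Iic]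
    rcases lt_trichotomy (y j) t with h | h | h
    · simp [h, h.le, (sub_pos.2 h).ne']; norm_num
    · simp [h]
    · simp [h.not_gt, h.not_ge, (sub_neg.2 h).ne]
  simp_rw [h]
  rw [integral_add ((integrable_const _).indicator (hj measurableSet_Iio))
    ((integrable_const _).indicator (hj measurableSet_Iic)),
    integral_indicator_const _ (hj measurableSet_Iio),
    integral_indicator_const _ (hj measurableSet_Iic), normCDF, marginal,
    map_measureReal_apply hj measurableSet_Iio, map_measureReal_apply hj measurableSet_Iic]
  simp only [smul_eq_mul]
  ring

lemma normCDF_nonneg (i : Fin a) (j : Fin d) (t : ℝ) : 0 ≤ normCDF Q i j t :=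
  div_nonneg (add_nonneg measureReal_nonneg measureReal_nonneg) zero_le_two

variable [∀ i, IsProbabilityMeasure (Q i)]

instance isProbabilityMeasure_marginal (i : Fin a) (j : Fin d) :
    IsProbabilityMeasure (marginal Q i j) :=
  Measure.isProbabilityMeasure_map (measurable_pi_apply j).aemeasurable

lemma normCDF_le_one (i : Fin a) (j : Fin d) (t : ℝ) : normCDF Q i j t ≤ 1 := by
  have h1 : (marginal Q i j).real (Set.Iio t) ≤ 1 := measureReal_le_one
  have h2 : (marginal Q i j).real (Set.Iic t) ≤ 1 := measureReal_le_one
  rw [normCDF]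
  linarith

lemma measurable_normCDF (i : Fin a) (j : Fin d) : Measurable (normCDF Q i j) := by
  refine Monotone.measurable fun s t hst => ?_
  have h1 : (marginal Q i j).real (Set.Iio s) ≤ (marginal Q i j).real (Set.Iio t) :=
    measureReal_mono (Set.Iio_subset_Iio hst)
  have h2 : (marginal Q i j).real (Set.Iic s) ≤ (marginal Q i j).real (Set.Iic t) :=
    measureReal_mono (Set.Iic_subset_Iic.2 hst)
  rw [normCDF, normCDF]
  linarith

lemma abs_cFun_sub_normCDF_le_one (i : Fin a) (j : Fin d) (u t : ℝ) :
    |cFun u - normCDF Q i j t| ≤ 1 := by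
  rw [abs_le]
  constructor <;> linarith [cFun_nonneg u, cFun_le_one u, normCDF_nonneg Q i j t,
    normCDF_le_one Q i j t]

lemma effect_eq_integral (i l : Fin a) (j : Fin d) :
    effect Q i l j = ∫ y, normCDF Q i j (y j) ∂(Q l) := by
  rw [effect, marginal, integral_map (measurable_pi_apply j).aemeasurable
    (measurable_normCDF Q i j).aestronglyMeasurable]

end Population

/-! ### Consistency of the empirical covariances -/

section Sample

variable {Ω : Type*} [MeasurableSpace Ω] {P : Measure Ω} [IsProbabilityMeasure P] {a d : ℕ}
  {Q : Fin a → Measure (Fin d → ℝ)} {X : Fin a → ℕ → Ω → Fin d → ℝ}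

/-- Law of large numbers within one group. -/
lemma tendsto_empMean (hX_meas : ∀ i k, Measurable (X i k))
    (hX_law : ∀ i k, P.map (X i k) = Q i)
    (hX_indep : iIndepFun (fun s : Fin a × ℕ => X s.1 s.2) P) {n : ℕ → Fin a → ℕ} {l : Fin a}
    (hn : Tendsto (fun r => n r l) atTop atTop) {g : (Fin d → ℝ) → ℝ} (hg : Measurable g)
    (hb : ∀ y, |g y| ≤ 1) :
    Tendsto (fun p : ℕ × Ω => empMean (n p.1) (fun i k => X i k p.2) l g)
      (inMeasure P atTop) (𝓝 (∫ y, g y ∂(Q l))) := by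
  have hslln := strong_law_ae_real (μ := P) (fun k ω => g (X l k ω))
    (.of_bound (hg.comp (hX_meas l 0)).aestronglyMeasurable 1 (ae_of_all _ fun ω => hb _))
    (fun k k' hkk => (hX_indep.indepFun (i := (l, k)) (j := (l, k'))
      (by simpa using hkk)).comp hg hg)
    (fun k => (IdentDistrib.mk (hX_meas l k).aemeasurable (hX_meas l 0).aemeasurable
      (by rw [hX_law, hX_law])).comp hg)
  have hE : ∫ ω, g (X l 0 ω) ∂P = ∫ y, g y ∂(Q l) := by
    rw [← hX_law l 0, integral_map (hX_meas l 0).aemeasurable hg.aestronglyMeasurable]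
  rw [← hE]
  refine (tendstoInMeasure_const_iff (f := fun r ω => empMean (n r) (fun i k => X i k ω) l g)).1 ?_
  refine tendstoInMeasure_of_tendsto_ae (fun r => ?_) ?_
  · exact ((Finset.measurable_sum _ fun k _ => hg.comp (hX_meas l k)).const_mul
      _).aestronglyMeasurable
  · filter_upwards [hslln] with ω hω
    refine (hω.comp hn).congr fun r => ?_
    simp [empMean, div_eq_inv_mul]

variable [∀ i, IsProbabilityMeasure (Q i)]

/-- The residual `c(X_{ljk} - X_{ijm}) - F_{ij}(X_{ljk})`. -/
noncomputable def residual (Q : Fin a → Measure (Fin d → ℝ)) (i : Fin a) (j : Fin d)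
    (y z : Fin d → ℝ) : ℝ :=
  cFun (y j - z j) - normCDF Q i j (y j)

lemma measurable_residual (i : Fin a) (j : Fin d) :
    Measurable fun q : (Fin d → ℝ) × (Fin d → ℝ) => residual Q i j q.1 q.2 :=
  (measurable_cFun.comp (by fun_prop)).sub ((measurable_normCDF Q i j).comp (by fun_prop))

lemma abs_residual_le_one (i : Fin a) (j : Fin d) (y z : Fin d → ℝ) : |residual Q i j y z| ≤ 1 :=
  abs_cFun_sub_normCDF_le_one Q i j _ _

lemma integral_residual (i : Fin a) (j : Fin d) (y : Fin d → ℝ) :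
    ∫ z, residual Q i j y z ∂(Q i) = 0 := by
  simp only [residual]
  rw [integral_sub (integrable_cFun_sub Q i j _) (integrable_const _), ← normCDF_eq_integral]
  simp

lemma integrable_residual_mul (hX_meas : ∀ i k, Measurable (X i k)) (i : Fin a) (j : Fin d)
    (p q r : Fin a × ℕ) :
    Integrable (fun ω => residual Q i j (X p.1 p.2 ω) (X q.1 q.2 ω)
      * residual Q i j (X p.1 p.2 ω) (X r.1 r.2 ω)) P := by
  have hm := fun s : Fin a × ℕ => hX_meas s.1 s.2
  refine .of_bound (((measurable_residual i j).comp ((hm p).prodMk (hm q))).mul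
    ((measurable_residual i j).comp ((hm p).prodMk (hm r)))).aestronglyMeasurable 1
    (ae_of_all _ fun ω => ?_)
  rw [norm_mul]
  exact mul_le_one₀ (abs_residual_le_one _ _ _ _) (norm_nonneg _) (abs_residual_le_one _ _ _ _)

/-- `X i m` is independent of the pair formed by the observations `p` and `q`, which may coincide;
integrating it out first leaves the zero mean of the residual. -/
lemma integral_residual_mul_residual (hX_meas : ∀ i k, Measurable (X i k))
    (hX_law : ∀ i k, P.map (X i k) = Q i)
    (hX_indep : iIndepFun (fun s : Fin a × ℕ => X s.1 s.2) P) (i : Fin a) (j : Fin d)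
    (p q : Fin a × ℕ) (m : ℕ) (hp : p ≠ (i, m)) (hq : q ≠ (i, m)) :
    ∫ ω, residual Q i j (X p.1 p.2 ω) (X q.1 q.2 ω)
      * residual Q i j (X p.1 p.2 ω) (X i m ω) ∂P = 0 := by
  have hm := fun s : Fin a × ℕ => hX_meas s.1 s.2
  have hind := (hX_indep.indepFun_prodMk hm p q (i, m) hp hq).map_prod_eq_prod_map_map
    ((hm p).prodMk (hm q)).aemeasurable (hm (i, m)).aemeasurable
  rw [hX_law] at hind
  let φ : ((Fin d → ℝ) × (Fin d → ℝ)) × (Fin d → ℝ) → ℝ := fun w =>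
    residual Q i j w.1.1 w.1.2 * residual Q i j w.1.1 w.2
  have hφ : Measurable φ := ((measurable_residual i j).comp measurable_fst).mul
    ((measurable_residual i j).comp (by fun_prop : Measurable fun
      w : ((Fin d → ℝ) × (Fin d → ℝ)) × (Fin d → ℝ) => (w.1.1, w.2)))
  have h1 : ∫ ω, residual Q i j (X p.1 p.2 ω) (X q.1 q.2 ω)
      * residual Q i j (X p.1 p.2 ω) (X i m ω) ∂P
      = ∫ w, φ w ∂(P.map fun ω => ((X p.1 p.2 ω, X q.1 q.2 ω), X i m ω)) := by
    rw [integral_map (((hm p).prodMk (hm q)).prodMk (hm (i, m))).aemeasurable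
      hφ.aestronglyMeasurable]
  have : IsProbabilityMeasure (P.map fun ω => (X p.1 p.2 ω, X q.1 q.2 ω)) :=
    Measure.isProbabilityMeasure_map ((hm p).prodMk (hm q)).aemeasurable
  rw [h1, hind, integral_prod]
  · simp [φ, integral_const_mul, integral_residual]
  · refine .of_bound hφ.aestronglyMeasurable 1 (ae_of_all _ fun w => ?_)
    rw [norm_mul]
    exact mul_le_one₀ (abs_residual_le_one _ _ _ _) (norm_nonneg _) (abs_residual_le_one _ _ _ _)

lemma integral_residual_mul_residual_of_ne (hX_meas : ∀ i k, Measurable (X i k))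
    (hX_law : ∀ i k, P.map (X i k) = Q i)
    (hX_indep : iIndepFun (fun s : Fin a × ℕ => X s.1 s.2) P) (i : Fin a) (j : Fin d)
    (p : Fin a × ℕ) {m m' : ℕ} (hmm : m ≠ m') :
    ∫ ω, residual Q i j (X p.1 p.2 ω) (X i m ω)
      * residual Q i j (X p.1 p.2 ω) (X i m' ω) ∂P = 0 := by
  -- The evaluation point may be one of the two observations, but not both; the other one is
  -- integrated out.
  by_cases hp : p = (i, m')
  · simp_rw [mul_comm (residual Q i j (X p.1 p.2 _) (X i m _))]
    exact integral_residual_mul_residual hX_meas hX_law hX_indep i j p (i, m') m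
      (by rw [hp]; simpa using hmm.symm) (by simpa using hmm.symm)
  · exact integral_residual_mul_residual hX_meas hX_law hX_indep i j p (i, m) m' hp
      (by simpa using hmm)

/-- The residuals are orthogonal even when the evaluation point belongs to group `i`, so only the
`N` diagonal terms, each at most one, remain. -/
lemma integral_sum_residual_sq_le (hX_meas : ∀ i k, Measurable (X i k))
    (hX_law : ∀ i k, P.map (X i k) = Q i)
    (hX_indep : iIndepFun (fun s : Fin a × ℕ => X s.1 s.2) P) (i : Fin a) (j : Fin d)
    (p : Fin a × ℕ) (N : ℕ) :
    ∫ ω, (∑ m ∈ Finset.range N, residual Q i j (X p.1 p.2 ω) (X i m ω)) ^ 2 ∂P ≤ N := by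
  have hint := fun m m' => integrable_residual_mul (P := P) (Q := Q) hX_meas i j p (i, m) (i, m')
  simp_rw [sq, Finset.sum_mul_sum]
  rw [integral_finsetSum _ fun m _ => integrable_finsetSum _ fun m' _ => hint m m']
  have h (m : ℕ) (hm : m ∈ Finset.range N) :
      ∫ ω, ∑ m' ∈ Finset.range N, residual Q i j (X p.1 p.2 ω) (X i m ω)
        * residual Q i j (X p.1 p.2 ω) (X i m' ω) ∂P ≤ 1 := by
    rw [integral_finsetSum _ fun m' _ => hint m m', Finset.sum_eq_single_of_mem m hm fun m' _ hne =>
      integral_residual_mul_residual_of_ne hX_meas hX_law hX_indep i j p hne.symm]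
    calc _ ≤ ∫ _, (1 : ℝ) ∂P := by
          refine integral_mono (hint m m) (integrable_const _) fun ω => ?_
          have := abs_residual_le_one (Q := Q) i j (X p.1 p.2 ω) (X i m ω)
          simp only
          rw [← abs_mul_abs_self]
          exact mul_le_one₀ this (abs_nonneg _) this
      _ = 1 := by simp
  simpa using Finset.sum_le_sum h

lemma integral_abs_empCDF_sub_le (hX_meas : ∀ i k, Measurable (X i k))
    (hX_law : ∀ i k, P.map (X i k) = Q i)
    (hX_indep : iIndepFun (fun s : Fin a × ℕ => X s.1 s.2) P) (n : Fin a → ℕ) (i : Fin a)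
    (hi : 0 < n i) (j : Fin d) (p : Fin a × ℕ) :
    Integrable (fun ω => |empCDF n (fun i k => X i k ω) i j (X p.1 p.2 ω j)
      - normCDF Q i j (X p.1 p.2 ω j)|) P ∧
    ∫ ω, |empCDF n (fun i k => X i k ω) i j (X p.1 p.2 ω j)
      - normCDF Q i j (X p.1 p.2 ω j)| ∂P ≤ √(1 / (n i : ℝ)) := by
  have hn : (0 : ℝ) < n i := by exact_mod_cast hi
  have hm := fun s : Fin a × ℕ => hX_meas s.1 s.2
  have e (ω : Ω) : empCDF n (fun i k => X i k ω) i j (X p.1 p.2 ω j)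
      - normCDF Q i j (X p.1 p.2 ω j)
      = 1 / (n i : ℝ) * ∑ m ∈ Finset.range (n i), residual Q i j (X p.1 p.2 ω) (X i m ω) := by
    simp only [residual, empCDF, Finset.sum_sub_distrib, mul_sub]
    simp [hn.ne']
  simp_rw [e]
  set g : Ω → ℝ := fun ω =>
    1 / (n i : ℝ) * ∑ m ∈ Finset.range (n i), residual Q i j (X p.1 p.2 ω) (X i m ω) with hg
  have hgm : Measurable g := (Finset.measurable_sum _ fun m _ =>
    (measurable_residual i j).comp ((hm p).prodMk (hm (i, m)))).const_mul _
  have hgb (ω : Ω) : ‖g ω‖ ≤ 1 := by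
    rw [show g ω = _ from (e ω).symm, Real.norm_eq_abs, abs_le]
    constructor <;> linarith [empCDF_nonneg (n := n) (fun i k => X i k ω) i j (X p.1 p.2 ω j),
      empCDF_le_one (n := n) (fun i k => X i k ω) i j (X p.1 p.2 ω j),
      normCDF_nonneg Q i j (X p.1 p.2 ω j), normCDF_le_one Q i j (X p.1 p.2 ω j)]
  have hL2 : MemLp (fun ω => |g ω|) 2 P :=
    .of_bound hgm.abs.aestronglyMeasurable 1 (ae_of_all _ fun ω => by simpa using hgb ω)
  refine ⟨hL2.integrable one_le_two, Real.le_sqrt_of_sq_le ?_⟩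
  -- Nonnegativity of the variance of `|g|` gives `(E|g|)² ≤ E g²`.
  have hv := variance_nonneg (fun ω => |g ω|) P
  rw [variance_eq_sub hL2] at hv
  have hsq : P[(fun ω => |g ω|) ^ 2] ≤ 1 / (n i : ℝ) := by
    simp only [Pi.pow_apply, sq_abs, hg, mul_pow]
    rw [integral_const_mul]
    calc _ ≤ (1 / (n i : ℝ)) ^ 2 * n i := by
          gcongr
          exact integral_sum_residual_sq_le hX_meas hX_law hX_indep i j p (n i)
      _ = 1 / (n i : ℝ) := by field_simp
  linarith

/-- The empirical distribution functions are consistent, on average over the pooled sample. -/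
lemma tendsto_empMean_abs_sub (hX_meas : ∀ i k, Measurable (X i k))
    (hX_law : ∀ i k, P.map (X i k) = Q i)
    (hX_indep : iIndepFun (fun s : Fin a × ℕ => X s.1 s.2) P) {n : ℕ → Fin a → ℕ} (i l : Fin a)
    (hn : Tendsto (fun r => n r i) atTop atTop) (j : Fin d) :
    Tendsto (fun p : ℕ × Ω => empMean (n p.1) (fun i k => X i k p.2) l fun y =>
      |empCDF (n p.1) (fun i k => X i k p.2) i j (y j) - normCDF Q i j (y j)|)
      (inMeasure P atTop) (𝓝 0) := by
  set T : ℕ → Ω → ℝ := fun r ω => empMean (n r) (fun i k => X i k ω) l fun y =>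
      |empCDF (n r) (fun i k => X i k ω) i j (y j) - normCDF Q i j (y j)| with hT
  have hT0 (r : ℕ) (ω : Ω) : 0 ≤ T r ω :=
    mul_nonneg (by positivity) (Finset.sum_nonneg fun _ _ => abs_nonneg _)
  have hpos : ∀ᶠ r in atTop, 0 < n r i := hn.eventually_gt_atTop 0
  have hint (r : ℕ) (hr : 0 < n r i) : Integrable (T r) P :=
    (integrable_finsetSum _ fun k _ => (integral_abs_empCDF_sub_le hX_meas hX_law hX_indep (n r) i
      hr j (l, k)).1).const_mul _
  have hle (r : ℕ) (hr : 0 < n r i) : ∫ ω, T r ω ∂P ≤ √(1 / (n r i : ℝ)) := by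
    have h := fun k => integral_abs_empCDF_sub_le hX_meas hX_law hX_indep (n r) i hr j (l, k)
    simp only [hT, empMean]
    rw [integral_const_mul, integral_finsetSum _ fun k _ => (h k).1]
    -- Group `l` may be empty here; its average is then zero.
    rcases (n r l).eq_zero_or_pos with h0 | h0
    · simp [h0]
    rw [one_div_mul_eq_div, div_le_iff₀ (by positivity), mul_comm]
    simpa using Finset.sum_le_card_nsmul (Finset.range (n r l)) _ _ fun k _ => (h k).2
  refine (tendstoInMeasure_const_iff (f := T)).1 ?_
  rw [tendstoInMeasure_iff_dist]
  intro ε hε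
  have hlim : Tendsto (fun r => ENNReal.ofReal (√(1 / (n r i : ℝ)) / ε)) atTop (𝓝 0) := by
    rw [← ENNReal.ofReal_zero]
    refine (ENNReal.continuous_ofReal.tendsto 0).comp ?_
    have h1 : Tendsto (fun r => 1 / (n r i : ℝ)) atTop (𝓝 0) :=
      tendsto_one_div_atTop_nhds_zero_nat.comp hn
    have h2 := ((Real.continuous_sqrt.tendsto 0).comp h1).div_const ε
    simpa using h2
  refine tendsto_of_tendsto_of_tendsto_of_le_of_le' tendsto_const_nhds hlim
    (Eventually.of_forall fun _ => zero_le) ?_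
  filter_upwards [hpos] with r hr
  have hmk := mul_meas_ge_le_integral_of_nonneg (ae_of_all _ (hT0 r)) (hint r hr) ε
  have hset : {ω | ε ≤ dist (T r ω) 0} = {ω | ε ≤ T r ω} := by
    ext ω
    simp [abs_of_nonneg (hT0 r ω)]
  rw [hset, ENNReal.le_ofReal_iff_toReal_le (by finiteness) (by positivity), le_div_iff₀ hε,
    mul_comm]
  exact hmk.trans (hle r hr)

lemma abs_empMean_sub_le (n : Fin a → ℕ) (x : Fin a → ℕ → Fin d → ℝ) (l : Fin a)
    {g h u : (Fin d → ℝ) → ℝ} (hgh : ∀ y, |g y - h y| ≤ u y) :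
    |empMean n x l g - empMean n x l h| ≤ empMean n x l u := by
  rw [empMean, empMean, empMean, ← mul_sub, ← Finset.sum_sub_distrib, abs_mul,
    abs_of_nonneg (by positivity : 0 ≤ 1 / (n l : ℝ))]
  gcongr
  exact (Finset.abs_sum_le_sum_abs _ _).trans (Finset.sum_le_sum fun k _ => hgh _)

lemma empIntegral_eq_empMean (n : Fin a → ℕ) (x : Fin a → ℕ → Fin d → ℝ) (l : Fin a) (j : Fin d)
    (f : ℝ → ℝ) : empIntegral n x l j f = empMean n x l fun y => f (y j) := rfl

/-- Replacing `F̂` by `F` costs at most the mean absolute error over the sample, which vanishes in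
probability; the law of large numbers does the rest. -/
lemma tendsto_empIntegral_empCDF (hX_meas : ∀ i k, Measurable (X i k))
    (hX_law : ∀ i k, P.map (X i k) = Q i)
    (hX_indep : iIndepFun (fun s : Fin a × ℕ => X s.1 s.2) P) {n : ℕ → Fin a → ℕ}
    (hn : ∀ i, Tendsto (fun r => n r i) atTop atTop) (i l : Fin a) (j : Fin d) :
    Tendsto (fun p : ℕ × Ω => empIntegral (n p.1) (fun i k => X i k p.2) l j
      (empCDF (n p.1) (fun i k => X i k p.2) i j)) (inMeasure P atTop) (𝓝 (effect Q i l j)) := by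
  have h1 := tendsto_empMean hX_meas hX_law hX_indep (hn l) (g := fun y => normCDF Q i j (y j))
    ((measurable_normCDF Q i j).comp (measurable_pi_apply j)) fun y => by
      rw [abs_of_nonneg (normCDF_nonneg _ _ _ _)]
      exact normCDF_le_one _ _ _ _
  have h2 := tendsto_empMean_abs_sub hX_meas hX_law hX_indep i l (hn i) j
  rw [effect_eq_integral]
  refine tendsto_of_tendsto_of_dist h1 (squeeze_zero (fun _ => dist_nonneg) (fun p => ?_) h2)
  rw [dist_comm, Real.dist_eq, empIntegral_eq_empMean]
  exact abs_empMean_sub_le _ _ _ fun y => le_rfl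

lemma tendsto_empCov (hX_meas : ∀ i k, Measurable (X i k))
    (hX_law : ∀ i k, P.map (X i k) = Q i)
    (hX_indep : iIndepFun (fun s : Fin a × ℕ => X s.1 s.2) P) {n : ℕ → Fin a → ℕ}
    (hn : ∀ i, Tendsto (fun r => n r i) atTop atTop) (i i' l : Fin a) (j j' : Fin d) :
    Tendsto (fun p : ℕ × Ω => empCov (n p.1) (fun i k => X i k p.2) i i' l j j')
      (inMeasure P atTop) (𝓝 (crossCov Q i i' l j j')) := by
  refine Tendsto.sub ?_ ((tendsto_empIntegral_empCDF hX_meas hX_law hX_indep hn i l j).mul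
    (tendsto_empIntegral_empCDF hX_meas hX_law hX_indep hn i' l j'))
  have h1 := tendsto_empMean hX_meas hX_law hX_indep (hn l)
    (((measurable_normCDF Q i j).comp (measurable_pi_apply j)).mul
      ((measurable_normCDF Q i' j').comp (measurable_pi_apply j'))) fun y => by
      simp only [Pi.mul_apply, Function.comp_apply]
      rw [abs_of_nonneg (mul_nonneg (normCDF_nonneg _ _ _ _) (normCDF_nonneg _ _ _ _))]
      exact mul_le_one₀ (normCDF_le_one _ _ _ _) (normCDF_nonneg _ _ _ _) (normCDF_le_one _ _ _ _)
  have h2 := (tendsto_empMean_abs_sub hX_meas hX_law hX_indep i l (hn i) j).add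
    (tendsto_empMean_abs_sub hX_meas hX_law hX_indep i' l (hn i') j')
  rw [add_zero] at h2
  refine tendsto_of_tendsto_of_dist h1 (squeeze_zero (fun _ => dist_nonneg) (fun p => ?_) h2)
  rw [dist_comm, empMean.eq_def _ _ _ (fun y => |empCDF _ _ i j (y j) - _|),
    empMean.eq_def _ _ _ (fun y => |empCDF _ _ i' j' (y j') - _|), ← mul_add,
    ← Finset.sum_add_distrib]
  refine abs_empMean_sub_le _ _ _ (u := fun y =>
    |empCDF (n p.1) (fun i k => X i k p.2) i j (y j) - normCDF Q i j (y j)|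
    + |empCDF (n p.1) (fun i k => X i k p.2) i' j' (y j') - normCDF Q i' j' (y j')|) fun y => ?_
  have e1 := empCDF_nonneg (n := n p.1) (fun i k => X i k p.2) i j (y j)
  have e2 := empCDF_le_one (n := n p.1) (fun i k => X i k p.2) i j (y j)
  have e3 := normCDF_nonneg Q i' j' (y j')
  have e4 := normCDF_le_one Q i' j' (y j')
  simp only [Pi.mul_apply, Function.comp_apply]
  generalize empCDF (n p.1) (fun i k => X i k p.2) i j (y j) = A at *
  generalize empCDF (n p.1) (fun i k => X i k p.2) i' j' (y j') = B at *
  generalize normCDF Q i j (y j) = A' at *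
  generalize normCDF Q i' j' (y j') = B' at *
  -- All four values lie in `[0, 1]`, so the error of the product is at most the sum of the errors.
  calc |A * B - A' * B'| = |(A - A') * B' + A * (B - B')| := by congr 1; ring
    _ ≤ |A - A'| * |B'| + |A| * |B - B'| := by
        rw [← abs_mul, ← abs_mul]; exact abs_add_le _ _
    _ ≤ |A - A'| * 1 + 1 * |B - B'| := by
        rw [abs_of_nonneg e1, abs_of_nonneg e3]; gcongr
    _ = _ := by ring

end Sample

/-! ### Conditional laws under independence -/

section Conditioning

/-- By Fubini, the kernel sending `x` to the law of `g (x, Y)` disintegrates the joint law of `X`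
and `g (X, Y)`; conditional distributions are almost everywhere unique. -/
lemma condDistrib_ae_eq_map_of_indepFun {Ω α β E : Type*} [MeasurableSpace Ω] [MeasurableSpace α]
    [MeasurableSpace β] [MeasurableSpace E] [StandardBorelSpace E] [Nonempty E] {P : Measure Ω}
    [IsProbabilityMeasure P] {X : Ω → α} {Y : Ω → β} (hX : Measurable X) (hY : Measurable Y)
    (hXY : IndepFun X Y P) {g : α × β → E} (hg : Measurable g) :
    ∀ᵐ ω ∂P, condDistrib (fun ω => g (X ω, Y ω)) X P (X ω) = P.map fun ω' => g (X ω, Y ω') := by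
  let κ : Kernel α E := (Kernel.prodMkLeft Unit (Kernel.id ×ₖ Kernel.const α (P.map Y))).comap
    (fun x => ((), x)) (by fun_prop) |>.map g
  have : IsProbabilityMeasure (P.map Y) := Measure.isProbabilityMeasure_map hY.aemeasurable
  have : IsProbabilityMeasure (P.map X) := Measure.isProbabilityMeasure_map hX.aemeasurable
  have hκ (x : α) : κ x = P.map fun ω' => g (x, Y ω') := by
    simp only [κ]
    rw [Kernel.map_apply _ hg, Kernel.comap_apply, Kernel.prodMkLeft_apply, Kernel.prod_apply,
      Kernel.id_apply, Kernel.const_apply, Measure.dirac_prod, Measure.map_map hg (by fun_prop),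
      Measure.map_map (by fun_prop) hY]
    rfl
  have : IsMarkovKernel κ := ⟨fun x => by
    rw [hκ]; exact Measure.isProbabilityMeasure_map (by fun_prop)⟩
  have h := condDistrib_ae_eq_of_measure_eq_compProd (μ := P) (Y := fun ω => g (X ω, Y ω)) X
    (κ := κ) (by fun_prop) (by
      ext s hs
      rw [Measure.compProd_apply hs]
      have h1 : P.map (fun ω => (X ω, g (X ω, Y ω)))
          = ((P.map X).prod (P.map Y)).map fun w => (w.1, g w) := by
        rw [← hXY.map_prod_eq_prod_map_map hX.aemeasurable hY.aemeasurable,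
          Measure.map_map (by fun_prop) (by fun_prop)]
        rfl
      rw [h1, Measure.map_apply (by fun_prop) hs,
        Measure.prod_apply ((by fun_prop : Measurable fun w : α × β => (w.1, g w)) hs)]
      refine lintegral_congr fun x => ?_
      rw [hκ, Measure.map_apply (by fun_prop) (measurable_prodMk_left hs),
        Measure.map_apply hY (measurable_prodMk_left
          ((by fun_prop : Measurable fun w : α × β => (w.1, g w)) hs))]
      rfl)
  filter_upwards [ae_of_ae_map hX.aemeasurable h] with ω hω
  rw [hω, hκ]

end Conditioning

/-! ### Conditioning on the pooled sample -/

section Pooled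

variable {a d : ℕ}

/-- The data array with the given pooled sample and zeros elsewhere. -/
noncomputable def unpool (n : Fin a → ℕ) (s : ((i : Fin a) × Fin (n i)) → Fin d → ℝ) (i : Fin a)
    (k : ℕ) : Fin d → ℝ :=
  if h : k < n i then s ⟨i, k, h⟩ else 0

/-- The statistic reads only observed individuals, so it is a function of the pooled sample and the
multipliers, as freezing the data requires. -/
lemma bootVector_unpool_pooled (n : Fin a → ℕ) (x : Fin a → ℕ → Fin d → ℝ) (m : Fin a → ℕ → ℝ) :
    bootVector n (unpool n (pooled n x)) m = bootVector n x m := by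
  have h0 (i : Fin a) (k : ℕ) (hk : k ∈ Finset.range (n i)) :
      unpool n (pooled n x) i k = x i k := by
    simp [unpool, pooled, Finset.mem_range.1 hk]
  have h1 : empCDF n (unpool n (pooled n x)) = empCDF n x := by
    ext i j t
    simp only [empCDF]
    rw [Finset.sum_congr rfl fun k hk => by rw [h0 i k hk]]
  have h2 : bootCDF n (unpool n (pooled n x)) m = bootCDF n x m := by
    ext i j t
    simp only [bootCDF, h1]
    rw [Finset.sum_congr rfl fun k hk => by rw [h0 i k hk]]
  have h3 : empIntegral n (unpool n (pooled n x)) = empIntegral n x := by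
    ext i j f
    simp only [empIntegral]
    rw [Finset.sum_congr rfl fun k hk => by rw [h0 i k hk]]
  have h4 : bootMeanCDF n (unpool n (pooled n x)) m = bootMeanCDF n x m := by
    ext j t
    simp only [bootMeanCDF, h2]
  simp only [bootVector, bootEffect, h2, h3, h4]

lemma measurable_unpool (n : Fin a → ℕ) :
    Measurable (unpool n : (((i : Fin a) × Fin (n i)) → Fin d → ℝ) → Fin a → ℕ → Fin d → ℝ) := by
  refine measurable_pi_lambda _ fun i => measurable_pi_lambda _ fun k => ?_
  unfold unpool
  split_ifs
  · exact measurable_pi_apply _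
  · exact measurable_const

attribute [fun_prop] measurable_cFun

lemma measurable_bootVector (n : Fin a → ℕ) {β : Type*} [MeasurableSpace β]
    {x : β → Fin a → ℕ → Fin d → ℝ} {m : β → Fin a → ℕ → ℝ} (hx : Measurable x)
    (hm : Measurable m) : Measurable fun w => bootVector n (x w) (m w) := by
  have : Measurable fun w => fun s : Fin a × Fin d =>
      √(totalSize n : ℝ) * bootEffect n (x w) (m w) s.1 s.2 := by
    unfold bootEffect empIntegral bootMeanCDF bootCDF empCDF
    fun_prop
  exact (WithLp.measurable_toLp 2 _).comp this

/-- Given the pooled sample, the data can be treated as constants. -/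
lemma condDistrib_bootVector {Ω : Type*} [MeasurableSpace Ω] {P : Measure Ω}
    [IsProbabilityMeasure P] {X : Fin a → ℕ → Ω → Fin d → ℝ} {D : Fin a → ℕ → Ω → ℝ}
    (hX : ∀ i k, Measurable (X i k)) (hD : ∀ i k, Measurable (D i k))
    (hXD : IndepFun (fun ω (s : Fin a × ℕ) => X s.1 s.2 ω) (fun ω (s : Fin a × ℕ) => D s.1 s.2 ω) P)
    (n : Fin a → ℕ) :
    ∀ᵐ ω ∂P, condDistrib (fun ω' => bootVector n (fun i k => X i k ω') (fun i k => D i k ω'))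
        (fun ω' => pooled n (fun i k => X i k ω')) P (pooled n (fun i k => X i k ω))
      = P.map fun ω' => bootVector n (fun i k => X i k ω) (fun i k => D i k ω') := by
  have hpool : Measurable fun x : Fin a × ℕ → Fin d → ℝ => pooled n fun i k => x (i, k) :=
    measurable_pi_lambda _ fun s => measurable_pi_apply _
  have hX' : Measurable fun ω => pooled n fun i k => X i k ω :=
    hpool.comp (measurable_pi_lambda _ fun s => hX s.1 s.2)
  have hD' : Measurable fun ω (s : Fin a × ℕ) => D s.1 s.2 ω :=
    measurable_pi_lambda _ fun s => hD s.1 s.2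
  have hXY : IndepFun (fun ω => pooled n fun i k => X i k ω)
      (fun ω (s : Fin a × ℕ) => D s.1 s.2 ω) P := hXD.comp hpool measurable_id
  have hcurry : Measurable fun (m : Fin a × ℕ → ℝ) i k => m (i, k) := by fun_prop
  have hg : Measurable fun w : (((i : Fin a) × Fin (n i)) → Fin d → ℝ) × (Fin a × ℕ → ℝ) =>
      bootVector n (unpool n w.1) fun i k => w.2 (i, k) := by
    have h1 : Measurable fun w : (((i : Fin a) × Fin (n i)) → Fin d → ℝ) × (Fin a × ℕ → ℝ) =>
        unpool n w.1 := (measurable_unpool n).comp measurable_fst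
    have h2 : Measurable fun w : (((i : Fin a) × Fin (n i)) → Fin d → ℝ) × (Fin a × ℕ → ℝ) =>
        fun (i : Fin a) (k : ℕ) => w.2 (i, k) := hcurry.comp measurable_snd
    exact measurable_bootVector n h1 h2
  have h := condDistrib_ae_eq_map_of_indepFun hX' hD' hXY hg
  simpa only [bootVector_unpool_pooled] using h

end Pooled

end MannWhitney

/-! ### The conditional central limit theorem -/

open MannWhitney

/-- The data `X i k` and the multipliers `D i k` live on one probability space; at stage `r` the
first `n r i` individuals of each group `i` are used. The convergence is that of the bounded
Lipschitz distance between the conditional law of `p⋆` given the pooled sample and `N(0, Σ)` to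
zero in probability; `P` of an arbitrary set is its outer probability. -/
theorem theorem2 {Ω : Type*} [MeasurableSpace Ω] (P : Measure Ω) [IsProbabilityMeasure P]
    {a d : ℕ} (Q : Fin a → Measure (Fin d → ℝ))
    (X : Fin a → ℕ → Ω → Fin d → ℝ) (D : Fin a → ℕ → Ω → ℝ)
    (hX_meas : ∀ i k, Measurable (X i k))
    (hX_law : ∀ i k, P.map (X i k) = Q i)
    (hX_indep : iIndepFun (fun s : Fin a × ℕ => X s.1 s.2) P)
    (hD_meas : ∀ i k, Measurable (D i k))
    (hD_ident : ∀ i k i' k', IdentDistrib (D i k) (D i' k') P P)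
    (hD_indep : iIndepFun (fun s : Fin a × ℕ => D s.1 s.2) P)
    (hD_memLp : ∀ i k, MemLp (D i k) 2 P)
    (hD_mean : ∀ i k, ∫ ω, D i k ω ∂P = 0)
    (hD_var : ∀ i k, Var[D i k; P] = 1)
    (hD_tail : ∀ i k,
      IntegrableOn (fun u : ℝ => √(P.real {ω | u < |D i k ω|})) (Set.Ioi 0))
    (hXD : IndepFun (fun ω (s : Fin a × ℕ) => X s.1 s.2 ω) (fun ω (s : Fin a × ℕ) => D s.1 s.2 ω) P)
    (n : ℕ → Fin a → ℕ) (lam : Fin a → ℝ)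
    (hN : Tendsto (fun r => MannWhitney.totalSize (n r)) atTop atTop)
    (hlam : ∀ i, lam i ∈ Set.Ioo (0 : ℝ) 1)
    (hn : ∀ i, Tendsto (fun r => (n r i : ℝ) / (MannWhitney.totalSize (n r) : ℝ)) atTop
      (𝓝 (lam i))) :
    (MannWhitney.limitCov Q lam).PosSemidef ∧
    TendstoInMeasure P
      (fun r ω => MannWhitney.dBL
        (condDistrib
          (fun ω' => MannWhitney.bootVector (n r) (fun i k => X i k ω') (fun i k => D i k ω'))
          (fun ω' => MannWhitney.pooled (n r) (fun i k => X i k ω')) P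
          (MannWhitney.pooled (n r) (fun i k => X i k ω)))
        (multivariateGaussian 0 (MannWhitney.limitCov Q lam)))
      atTop (fun _ => 0) := by
  have hQ (i : Fin a) : IsProbabilityMeasure (Q i) :=
    hX_law i 0 ▸ Measure.isProbabilityMeasure_map (hX_meas i 0).aemeasurable
  have hN' : Tendsto (fun r => (totalSize (n r) : ℝ)) atTop atTop :=
    tendsto_natCast_atTop_atTop.comp hN
  have hn_top (i : Fin a) : Tendsto (fun r => n r i) atTop atTop := by
    rw [← tendsto_natCast_atTop_iff (R := ℝ)]
    refine ((hn i).pos_mul_atTop (hlam i).1 hN').congr' ?_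
    filter_upwards [hN'.eventually_gt_atTop 0] with r hr
    exact div_mul_cancel₀ _ hr.ne'
  have hn_pos : ∀ᶠ r in atTop, ∀ i, 0 < n r i :=
    eventually_all.2 fun i => (hn_top i).eventually_gt_atTop 0
  have hn_inv (i : Fin a) : Tendsto (fun r => (totalSize (n r) : ℝ) / n r i) atTop
      (𝓝 (1 / lam i)) := by
    simpa using (hn i).inv₀ (hlam i).1.ne'
  have hβ : Tendsto (fun r => ∑ i, √(totalSize (n r) : ℝ) / n r i) atTop (𝓝 0) := by
    rw [← Finset.sum_const_zero (ι := Fin a) (s := Finset.univ)]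
    refine tendsto_finsetSum _ fun i _ => ?_
    -- `√N / n_i = (N / n_i) * N^(-1/2)`, with the first factor convergent.
    have h := (hn_inv i).mul (tendsto_inv_atTop_zero.comp (Real.tendsto_sqrt_atTop.comp hN'))
    rw [mul_zero] at h
    refine h.congr fun r => ?_
    simp only [Function.comp_apply]
    rw [← div_eq_mul_inv, div_right_comm, Real.div_sqrt]
  have hcov : Tendsto (fun (p : ℕ × Ω) s s' => ∑ q ∈ individuals (n p.1),
      weight (n p.1) (fun i k => X i k p.2) q s * weight (n p.1) (fun i k => X i k p.2) q s')
      (inMeasure P atTop) (𝓝 fun s s' => limitCov Q lam s s') := by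
    refine tendsto_pi_nhds.2 fun s => tendsto_pi_nhds.2 fun s' => ?_
    rw [limitCov_eq_sum_contrast]
    have h : Tendsto (fun p : ℕ × Ω => ∑ l, (totalSize (n p.1) : ℝ) / n p.1 l * (1 / (a : ℝ) ^ 2 *
        ∑ i, ∑ i', contrast s.1 l i * contrast s'.1 l i'
          * empCov (n p.1) (fun i k => X i k p.2) i i' l s.2 s'.2)) (inMeasure P atTop)
        (𝓝 (∑ l, 1 / lam l * (1 / (a : ℝ) ^ 2 * ∑ i, ∑ i',
          contrast s.1 l i * contrast s'.1 l i' * crossCov Q i i' l s.2 s'.2))) :=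
      tendsto_finsetSum _ fun l _ => ((hn_inv l).comp (tendsto_fst_inMeasure P atTop)).mul
        (.const_mul _ (tendsto_finsetSum _ fun i _ => tendsto_finsetSum _ fun i' _ =>
          .const_mul _ (tendsto_empCov hX_meas hX_law hX_indep hn_top i i' l s.2 s'.2)))
    refine h.congr' ?_
    filter_upwards [(tendsto_fst_inMeasure P atTop).eventually hn_pos] with p hp
    exact (sum_weight_mul_weight _ hp s s').symm
  have hcov' (s s' : Fin a × Fin d) := tendsto_pi_nhds.1 (tendsto_pi_nhds.1 hcov s) s'
  have hne := inMeasure_neBot P (atTop : Filter ℕ)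
  -- `Σ` is a limit in probability of Gram matrices.
  have hpsd : (limitCov Q lam).PosSemidef := by
    refine .of_dotProduct_mulVec_nonneg ?_ fun t => ?_
    · ext s s'
      rw [Matrix.conjTranspose_apply, star_trivial]
      refine tendsto_nhds_unique (hcov' s' s) ((hcov' s s').congr fun p => ?_)
      exact Finset.sum_congr rfl fun q _ => mul_comm _ _
    · have h : Tendsto (fun p : ℕ × Ω => ∑ s, ∑ s', t s * t s' * ∑ q ∈ individuals (n p.1),
          weight (n p.1) (fun i k => X i k p.2) q s * weight (n p.1) (fun i k => X i k p.2) q s')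
          (inMeasure P atTop) (𝓝 (∑ s, ∑ s', t s * t s' * limitCov Q lam s s')) :=
        tendsto_finsetSum _ fun s _ => tendsto_finsetSum _ fun s' _ => (hcov' s s').const_mul _
      have h0 := ge_of_tendsto' h fun p => (Finset.sum_nonneg fun q _ => sq_nonneg _).trans_eq
        (sum_inner_sq (individuals (n p.1)) (weight (n p.1) fun i k => X i k p.2)
          (WithLp.toLp 2 t))
      refine h0.trans_eq ?_
      simp only [dotProduct, Matrix.mulVec, Finset.mul_sum, star_trivial]
      exact Finset.sum_congr rfl fun s _ => Finset.sum_congr rfl fun s' _ => by ring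
  refine ⟨hpsd, ?_⟩
  -- Without groups the total size would be constantly zero.
  obtain ⟨i₀⟩ : Nonempty (Fin a) := by
    by_contra h
    rw [not_nonempty_iff] at h
    simp only [totalSize, Finset.univ_eq_empty, Finset.sum_empty] at hN
    exact not_tendsto_const_atTop _ _ hN
  have hρ : IsProbabilityMeasure (P.map (D i₀ 0)) :=
    Measure.isProbabilityMeasure_map (hD_meas i₀ 0).aemeasurable
  have hmean : ∫ u, u ∂(P.map (D i₀ 0)) = 0 := by
    rw [integral_map (hD_meas i₀ 0).aemeasurable (by fun_prop), hD_mean]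
  have hvar : ∫ u, u ^ 2 ∂(P.map (D i₀ 0)) = 1 := by
    rw [integral_map (hD_meas i₀ 0).aemeasurable (by fun_prop), ← hD_var i₀ 0,
      variance_of_integral_eq_zero (hD_meas i₀ 0).aemeasurable (hD_mean i₀ 0)]
  -- The index `p = (r, ω)` carries the frozen data; the law is taken over a separate `ω'` entering
  -- only through the multipliers.
  have hclt := tendsto_dBL_map_sum_smul (P := P) (D := fun q : (_ : Fin a) × ℕ => D q.1 q.2)
    (fun q => hD_meas q.1 q.2)
    (hD_indep.precomp (g := fun q : (_ : Fin a) × ℕ => (q.1, q.2)) (by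
      rintro ⟨i, k⟩ ⟨i', k'⟩ h
      simpa using h))
    (fun q => (hD_ident q.1 q.2 i₀ 0).map_eq) hmean hvar
    (S := fun p : ℕ × Ω => individuals (n p.1))
    (v := fun p => weight (n p.1) fun i k => X i k p.2)
    (fun p q _ s => abs_weight_le _ q s) (hβ.comp (tendsto_fst_inMeasure P atTop)) hpsd hcov
  have hboot : TendstoInMeasure P (fun r ω => dBL
      (P.map fun ω' => bootVector (n r) (fun i k => X i k ω) fun i k => D i k ω')
      (multivariateGaussian 0 (limitCov Q lam))) atTop fun _ => 0 := by
    rw [tendstoInMeasure_const_iff]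
    refine hclt.congr' ?_
    filter_upwards [(tendsto_fst_inMeasure P atTop).eventually hn_pos] with p hp
    simp_rw [bootVector_eq_sum _ hp]
  -- For each `r` the conditional distribution is the frozen-data law for almost every `ω`, which is
  -- enough for convergence in measure.
  refine hboot.congr_left fun r => ?_
  have hcond := condDistrib_bootVector hX_meas hD_meas hXD (n r)
  filter_upwards [hcond] with ω hω
  rw [hω]
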